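/- Let $d\ge 1$, $\delta>0$, and let $\|\cdot\|$ be the Euclidean norm on $\mathbb{R}^d$. For each $x\in\mathbb{R}^d$ let $\Xi(x)$ be a probability distribution on a measurable space $S$ (depending measurably on $x$), let $F:\mathbb{R}^d\times S\to\mathbb{R}$, $(x,\xi)\mapsto F(x;\xi)$, be measurable, and put $f(x)=\mathbb{E}_{\xi\sim\Xi(x)}[F(x;\xi)]$. Assume that, for some reals $\sigma, L$, * for every $x$, $F(x;\xi)$ is integrable under $\xi\sim\Xi(x)$, and $\mathbb{E}_{\xi\sim\Xi(x)}\big[|F(x;\xi)-f(x)|^2\big]\le\sigma^2$; * $|f(x)-f(y)|\le L\|x-y\|$ for all $x,y\in\mathbb{R}^d$. Let $f_\delta(x)=\mathbb{E}_{v\sim\mathrm{Unif}(\mathbb{B}^d)}[f(x+\delta v)]$, where $\mathbb{B}^d$ is the closed unit ball, and let $\mathbb{S}^{d-1}$ be the unit sphere of $\mathbb{R}^d$. On a probability space, let $\mathcal{F}$ be a sub-$\sigma$-algebra (the past), $y$ an $\mathcal{F}$-measurable random point of $\mathbb{R}^d$, $u$ a random direction which, conditionally on $\mathcal{F}$, is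 uniformly distributed on $\mathbb{S}^{d-1}$, and $\xi^+,\xi^-$ random samples in $S$ which, conditionally on $\mathcal{F}$ and $u$, are independent with $\xi^+\sim\Xi(y+\delta u)$ and $\xi^-\sim\Xi(y-\delta u)$. Define the two-point estimator $$g=\frac{d}{2\delta}\big(F(y+\delta u;\xi^+)-F(y-\delta u;\xi^-)\big)\,u .$$ Then $f_\delta$ is differentiable on $\mathbb{R}^d$, $g$ is square integrable, and almost surely $$\mathbb{E}[g\mid\mathcal{F}]=\nabla f_\delta(y)\qquad\text{and}\qquad \mathbb{E}\big[\|g\|^2\mid\mathcal{F}\big]\le\frac{d^2\sigma^2}{2\delta^2}+16\sqrt{2\pi}\,d\,L^2 .$$ -/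

import Mathlib

open MeasureTheory ProbabilityTheory

noncomputable section

/-- The uniform distribution on the unit sphere of `ℝᵈ`: normalized surface measure. -/
def unifSphere (d : ℕ) : Measure (Metric.sphere (0 : EuclideanSpace ℝ (Fin d)) 1) :=
  ((volume : Measure (EuclideanSpace ℝ (Fin d))).toSphere Set.univ)⁻¹ •
    (volume : Measure (EuclideanSpace ℝ (Fin d))).toSphere

/-- The uniform distribution on the closed unit ball of `ℝᵈ`: normalized Lebesgue measure. -/
def unifBall (d : ℕ) : Measure (EuclideanSpace ℝ (Fin d)) :=
  (volume (Metric.closedBall (0 : EuclideanSpace ℝ (Fin d)) 1))⁻¹ •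
    volume.restrict (Metric.closedBall (0 : EuclideanSpace ℝ (Fin d)) 1)

/-- The `δ`-smoothed surrogate `f_δ(x) = 𝔼_{v ∼ Unif(𝔹ᵈ)} [f (x + δ v)]`. -/
def smoothed {d : ℕ} (δ : ℝ) (f : EuclideanSpace ℝ (Fin d) → ℝ)
    (x : EuclideanSpace ℝ (Fin d)) : ℝ :=
  ∫ v, f (x + δ • v) ∂(unifBall d)

/-- The decision-dependent objective `f(x) = 𝔼_{ξ ∼ D(x)} [F(x; ξ)]`. -/
def objective {d : ℕ} {S : Type*} [MeasurableSpace S] (D : Kernel (EuclideanSpace ℝ (Fin d)) S)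
    (F : EuclideanSpace ℝ (Fin d) → S → ℝ) (x : EuclideanSpace ℝ (Fin d)) : ℝ :=
  ∫ s, F x s ∂(D x)

/-- The oracle assumption: at every `x`, the value `F(x; ξ)` with `ξ ∼ D(x)` is integrable (its
expectation is `objective D F x` by definition) and
`𝔼_{ξ ∼ D(x)} |F(x; ξ) - f(x)|² ≤ σ²`, the expectation being taken in `[0, ∞]`. -/
structure OracleAssumption {d : ℕ} {S : Type*} [MeasurableSpace S]
    (D : Kernel (EuclideanSpace ℝ (Fin d)) S) (F : EuclideanSpace ℝ (Fin d) → S → ℝ)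
    (σ : ℝ) : Prop where
  integrable : ∀ x, Integrable (F x) (D x)
  variance_le : ∀ x,
    ∫⁻ s, ENNReal.ofReal (|F x s - objective D F x| ^ 2) ∂(D x) ≤ ENNReal.ofReal (σ ^ 2)

/-- `ν ω` is the conditional law of `X` given the σ-algebra `𝓖`:
`P(X ∈ B | 𝓖) = ν(B)` almost surely for every measurable `B`. -/
def HasCondLaw {Ω T : Type*} [MeasurableSpace Ω] [MeasurableSpace T] (P : Measure Ω)
    (𝓖 : MeasurableSpace Ω) (X : Ω → T) (ν : Ω → Measure T) : Prop :=
  ∀ B : Set T, MeasurableSet B →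
    P[(X ⁻¹' B).indicator (fun _ => (1 : ℝ)) | 𝓖] =ᵐ[P] fun ω => (ν ω).real B

/-- The two-point estimator
`g(y, u; ξ⁺, ξ⁻) = d / (2δ) * (F(y + δ u; ξ⁺) - F(y - δ u; ξ⁻)) u`. -/
def twoPoint {d : ℕ} {S : Type*} (δ : ℝ) (F : EuclideanSpace ℝ (Fin d) → S → ℝ)
    (y u : EuclideanSpace ℝ (Fin d)) (ξp ξm : S) : EuclideanSpace ℝ (Fin d) :=
  ((d : ℝ) / (2 * δ) * (F (y + δ • u) ξp - F (y - δ • u) ξm)) • u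

end

/-! ### Polar coordinates and the uniform distributions on the sphere and on the ball -/

section Polar

open scoped RealInnerProductSpace

variable {d : ℕ} [NeZero d]

/-! Given the past, `y` is frozen and the law of the direction and the two samples is an explicit
kernel evaluated at `y`. Both conditional expectations are therefore integrals at a fixed query
point (`condExp_ae_eq_integral_kernel`).

Mean. Averaging over the samples replaces `F` by the objective `f`. Differentiating `f_δ` under the
integral moves the derivative onto `f`, which is Lipschitz and hence differentiable almost
everywhere. The divergence theorem on the ball (`integral_lineDeriv_unifBall`) turns the mean
gradient into `d / δ` times the spherical mean of `f (x + δ u) u`, and antipodal symmetry gives the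
symmetric difference (`gradient_smoothed`).

Second moment. Since `‖u‖ = 1`, only the squared difference matters. Independence splits it into
noise, at most `2σ²`, and `(f (y + δ u) - f (y - δ u))²`. The crude bound `(2δL)²` would cost `d²
L²`. The factor `d` instead of `d²` comes from oddness in `u`: an odd `K`-Lipschitz function `ψ` has
second moment `O(K² / d)` on the sphere (`integral_sq_unifSphere_le_of_odd`).

This last fact is transferred from Gaussian space. The degree-one extension `H x = ‖x‖ ψ (x / ‖x‖)`
is `3K`-Lipschitz, and `𝔼 H(X)² = d 𝔼 ψ²`. For odd `H`, a half-turn of a Gaussian pair `(X, Y)`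
carries `X` to `-X` and changes `H` by `2 H(X)`. Rotation invariance makes all the small steps of
this turn equally distributed, which gives `4 𝔼 H² ≤ π² Lip(H)²`
(`integral_sq_stdGaussian_le_of_odd`). -/

lemma toSphere_univ_pos :
    0 < (volume : Measure (EuclideanSpace ℝ (Fin d))).toSphere.real Set.univ := by
  rw [Measure.toSphere_real_apply_univ, finrank_euclideanSpace_fin]
  have h1 : 0 < (volume : Measure (EuclideanSpace ℝ (Fin d))).real (Metric.ball 0 1) :=
    ENNReal.toReal_pos (Metric.measure_ball_pos _ _ one_pos).ne' measure_ball_lt_top.ne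
  have h2 : (0 : ℝ) < d := Nat.cast_pos.2 (NeZero.pos d)
  positivity

instance isProbabilityMeasure_unifSphere : IsProbabilityMeasure (unifSphere d) := by
  constructor
  have h := toSphere_univ_pos (d := d)
  rw [unifSphere, Measure.smul_apply, smul_eq_mul]
  refine ENNReal.inv_mul_cancel ?_ (measure_ne_top _ _)
  intro h0
  rw [measureReal_def, h0] at h
  simp at h

instance isProbabilityMeasure_unifBall : IsProbabilityMeasure (unifBall d) := by
  constructor
  rw [unifBall, Measure.smul_apply, smul_eq_mul, Measure.restrict_apply_univ]
  exact ENNReal.inv_mul_cancel (Metric.measure_closedBall_pos _ _ one_pos).ne'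
    measure_closedBall_lt_top.ne

/-- Integration in polar coordinates of the product of a radial function and a function which is
homogeneous of degree zero. -/
theorem integral_radial_mul_angular (a : ℝ → ℝ) (b : EuclideanSpace ℝ (Fin d) → ℝ) :
    ∫ x : EuclideanSpace ℝ (Fin d), a ‖x‖ * b (‖x‖⁻¹ • x) =
      (∫ u, b (u : EuclideanSpace ℝ (Fin d)) ∂(unifSphere d)) *
        ∫ x : EuclideanSpace ℝ (Fin d), a ‖x‖ := by
  -- The product formula for Bochner integrals needs no integrability, so `a` and `b` are arbitrary.
  -- Comparing `c = b` with `c = 1` eliminates the one-dimensional radial integral.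
  have key : ∀ c : EuclideanSpace ℝ (Fin d) → ℝ,
      ∫ x : EuclideanSpace ℝ (Fin d), a ‖x‖ * c (‖x‖⁻¹ • x) =
        (∫ u : Metric.sphere (0 : EuclideanSpace ℝ (Fin d)) 1,
          c (u : EuclideanSpace ℝ (Fin d)) ∂(volume.toSphere)) *
        ∫ r : Set.Ioi (0 : ℝ), a r
          ∂(Measure.volumeIoiPow (Module.finrank ℝ (EuclideanSpace ℝ (Fin d)) - 1)) := by
    intro c
    have h := (volume : Measure
      (EuclideanSpace ℝ (Fin d))).measurePreserving_homeomorphUnitSphereProd.integral_comp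
      (Homeomorph.measurableEmbedding _)
      (fun p : Metric.sphere (0 : EuclideanSpace ℝ (Fin d)) 1 × Set.Ioi (0 : ℝ) =>
        c (p.1 : EuclideanSpace ℝ (Fin d)) * a p.2)
    rw [integral_prod_mul (fun u : Metric.sphere (0 : EuclideanSpace ℝ (Fin d)) 1 =>
      c (u : EuclideanSpace ℝ (Fin d))) (fun r : Set.Ioi (0 : ℝ) => a r)] at h
    rw [← h]
    have h0 : ∫ x : EuclideanSpace ℝ (Fin d), a ‖x‖ * c (‖x‖⁻¹ • x) =
        ∫ x : ({0}ᶜ : Set (EuclideanSpace ℝ (Fin d))), a ‖x.1‖ * c (‖x.1‖⁻¹ • x.1)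
          ∂(volume.comap Subtype.val) := by
      rw [integral_subtype_comap (measurableSet_singleton _).compl
        fun x : EuclideanSpace ℝ (Fin d) => a ‖x‖ * c (‖x‖⁻¹ • x), restrict_compl_singleton]
    rw [h0]
    refine integral_congr_ae (.of_forall fun x => ?_)
    simp [mul_comm]
  have h1 := key b
  have h2 := key (fun _ => 1)
  simp only [mul_one, integral_const, smul_eq_mul] at h2
  rw [h1, h2, unifSphere, integral_smul_measure, smul_eq_mul, ENNReal.toReal_inv]
  have h0 := (toSphere_univ_pos (d := d)).ne'
  rw [measureReal_def] at h0 ⊢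
  field_simp

theorem integral_unifBall (b : EuclideanSpace ℝ (Fin d) → ℝ) :
    ∫ v, b v ∂(unifBall d) =
      (volume.real (Metric.ball (0 : EuclideanSpace ℝ (Fin d)) 1))⁻¹ *
        ∫ v in Metric.ball (0 : EuclideanSpace ℝ (Fin d)) 1, b v := by
  rw [unifBall, integral_smul_measure, Measure.addHaar_closedBall_eq_addHaar_ball,
    ENNReal.toReal_inv, smul_eq_mul, measureReal_def, setIntegral_congr_set]
  exact (ae_eq_of_subset_of_measure_ge Metric.ball_subset_closedBall
    (Measure.addHaar_closedBall_eq_addHaar_ball _ _ _).le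
    measurableSet_ball.nullMeasurableSet measure_closedBall_lt_top.ne).symm

/-- The `k`-th moment of the norm under the uniform distribution on the ball. -/
theorem integral_norm_pow_unifBall (k : ℕ) :
    ∫ v, ‖v‖ ^ k ∂(unifBall d) = d / (d + k) := by
  have hd : (0 : ℝ) < d := Nat.cast_pos.2 (NeZero.pos d)
  have h1 : 0 < (volume : Measure (EuclideanSpace ℝ (Fin d))).real (Metric.ball 0 1) :=
    ENNReal.toReal_pos (Metric.measure_ball_pos _ _ one_pos).ne' measure_ball_lt_top.ne
  have h2 : ∫ v in Metric.ball (0 : EuclideanSpace ℝ (Fin d)) 1, ‖v‖ ^ k =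
      ∫ v : EuclideanSpace ℝ (Fin d), (Set.Iio (1 : ℝ)).indicator (fun r => r ^ k) ‖v‖ := by
    rw [← integral_indicator measurableSet_ball]
    refine integral_congr_ae (.of_forall fun x => ?_)
    simp [Set.indicator]
  have h3 : ∫ r in Set.Ioi (0 : ℝ), r ^ (d - 1) • (Set.Iio (1 : ℝ)).indicator (fun r => r ^ k) r =
      1 / (d + k) := by
    have : ∀ r : ℝ, r ^ (d - 1) • (Set.Iio (1 : ℝ)).indicator (fun r => r ^ k) r =
        (Set.Iio (1 : ℝ)).indicator (fun r => r ^ (d - 1 + k)) r := by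
      intro r
      simp only [Set.indicator]
      split_ifs <;> simp [pow_add]
    simp_rw [this]
    rw [setIntegral_indicator measurableSet_Iio, Set.Ioi_inter_Iio, ← integral_Ioc_eq_integral_Ioo,
      ← intervalIntegral.integral_of_le zero_le_one, integral_pow]
    have : ((d - 1 + k : ℕ) : ℝ) + 1 = d + k := by
      rw [Nat.cast_add, Nat.cast_sub (NeZero.one_le), Nat.cast_one]; ring
    rw [this]
    simp
  rw [integral_unifBall, h2, integral_fun_norm_addHaar, finrank_euclideanSpace_fin, h3]
  simp only [nsmul_eq_mul, smul_eq_mul]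
  field_simp

/-- The uniform distribution on the sphere is invariant under the antipodal map. -/
theorem integral_unifSphere_neg (b : EuclideanSpace ℝ (Fin d) → ℝ) :
    ∫ u, b (-(u : EuclideanSpace ℝ (Fin d))) ∂(unifSphere d) =
      ∫ u, b (u : EuclideanSpace ℝ (Fin d)) ∂(unifSphere d) := by
  have hb : 0 < (volume : Measure (EuclideanSpace ℝ (Fin d))).real (Metric.ball 0 1) :=
    ENNReal.toReal_pos (Metric.measure_ball_pos _ _ one_pos).ne' measure_ball_lt_top.ne
  -- Any radial weight with nonzero integral would do: Lebesgue measure is symmetric, and the weight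
  -- is cancelled at the end.
  set a : ℝ → ℝ := (Set.Iio (1 : ℝ)).indicator 1
  have ha : ∫ x : EuclideanSpace ℝ (Fin d), a ‖x‖ ≠ 0 := by
    have : ∀ x : EuclideanSpace ℝ (Fin d), a ‖x‖ = (Metric.ball 0 1).indicator 1 x := by
      intro x; simp [a, Set.indicator]
    simp_rw [this]
    rw [integral_indicator_one measurableSet_ball]
    exact hb.ne'
  have h1 := integral_radial_mul_angular a b
  have h2 := integral_radial_mul_angular a (fun x => b (-x))
  rw [← integral_neg_eq_self] at h1
  simp only [norm_neg, smul_neg] at h1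
  rw [h1] at h2
  exact (mul_right_cancel₀ ha h2).symm

end Polar

/-! ### The divergence theorem on the ball for Lipschitz functions -/

section Divergence

open scoped RealInnerProductSpace Topology
open Filter

variable {d : ℕ}

/-- A Lipschitz cutoff function, supported on the unit ball, which increases to `1` on the
open unit ball as `k` tends to infinity. -/
noncomputable def ballCutoff (k : ℕ) (v : EuclideanSpace ℝ (Fin d)) : ℝ := 1 - (min ‖v‖ 1) ^ k

lemma ballCutoff_eq_zero {k : ℕ} {v : EuclideanSpace ℝ (Fin d)} (hv : 1 ≤ ‖v‖) :
    ballCutoff k v = 0 := by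
  simp [ballCutoff, hv]

lemma ballCutoff_of_norm_le {k : ℕ} {v : EuclideanSpace ℝ (Fin d)} (hv : ‖v‖ ≤ 1) :
    ballCutoff k v = 1 - ‖v‖ ^ k := by
  simp [ballCutoff, hv]

lemma abs_ballCutoff_le (k : ℕ) (v : EuclideanSpace ℝ (Fin d)) : |ballCutoff k v| ≤ 1 := by
  have h0 : 0 ≤ min ‖v‖ 1 := by positivity
  have h1 := pow_le_one₀ (n := k) h0 (min_le_right _ _)
  have h2 := pow_nonneg h0 k
  rw [ballCutoff, abs_le]
  constructor <;> linarith

lemma lipschitzWith_ballCutoff (k : ℕ) :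
    LipschitzWith k (ballCutoff k : EuclideanSpace ℝ (Fin d) → ℝ) := by
  refine LipschitzWith.of_dist_le_mul fun v w => ?_
  have hmin : |min ‖v‖ 1 - min ‖w‖ 1| ≤ ‖v - w‖ :=
    (abs_min_sub_min_le_max _ _ _ _).trans (by simpa using abs_norm_sub_norm_le v w)
  have hv : 0 ≤ min ‖v‖ 1 := by positivity
  have hw : 0 ≤ min ‖w‖ 1 := by positivity
  have hpow := abs_pow_sub_pow_le (min ‖v‖ 1) (min ‖w‖ 1) k
  have hmax : max |min ‖v‖ 1| |min ‖w‖ 1| ^ (k - 1) ≤ 1 := by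
    refine pow_le_one₀ (by positivity) ?_
    rw [abs_of_nonneg hv, abs_of_nonneg hw]
    exact max_le (min_le_right _ _) (min_le_right _ _)
  rw [Real.dist_eq, dist_eq_norm, ballCutoff, ballCutoff, sub_sub_sub_cancel_left, abs_sub_comm]
  calc _ ≤ _ := hpow
    _ ≤ |min ‖v‖ 1 - min ‖w‖ 1| * k * 1 := by gcongr
    _ ≤ ‖v - w‖ * k * 1 := by gcongr
    _ = _ := by simp [mul_comm]

lemma hasCompactSupport_ballCutoff (k : ℕ) :
    HasCompactSupport (ballCutoff k : EuclideanSpace ℝ (Fin d) → ℝ) := by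
  refine HasCompactSupport.intro (isCompact_closedBall 0 1) fun v hv => ballCutoff_eq_zero ?_
  simp only [Metric.mem_closedBall, dist_zero_right, not_le] at hv
  exact hv.le

/-- The even exponent makes the cutoff a polynomial in `‖v‖²` near `v`, so the origin is not
exceptional. -/
lemma lineDeriv_ballCutoff_of_norm_lt (j : ℕ) {v : EuclideanSpace ℝ (Fin d)} (hv : ‖v‖ < 1)
    (e : EuclideanSpace ℝ (Fin d)) :
    lineDeriv ℝ (ballCutoff (2 * (j + 1))) v e = -((2 * j + 2) * ‖v‖ ^ (2 * j) * ⟪v, e⟫) := by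
  have h1 : (ballCutoff (2 * (j + 1)) : EuclideanSpace ℝ (Fin d) → ℝ) =ᶠ[𝓝 v]
      fun w => 1 - (‖w‖ ^ 2) ^ (j + 1) := by
    filter_upwards [continuous_norm.continuousAt.eventually_lt continuousAt_const hv] with w hw
    rw [ballCutoff_of_norm_le hw.le, pow_mul]
  have h2 : HasFDerivAt (fun w : EuclideanSpace ℝ (Fin d) => 1 - (‖w‖ ^ 2) ^ (j + 1)) _ v :=
    (((hasStrictFDerivAt_norm_sq v).hasFDerivAt.pow (j + 1)).const_sub 1)
  rw [h1.lineDeriv_eq, h2.hasLineDerivAt e |>.lineDeriv]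
  simp [pow_mul]
  ring

lemma lineDeriv_ballCutoff_of_lt_norm (k : ℕ) {v : EuclideanSpace ℝ (Fin d)} (hv : 1 < ‖v‖)
    (e : EuclideanSpace ℝ (Fin d)) : lineDeriv ℝ (ballCutoff k) v e = 0 := by
  have h1 : (ballCutoff k : EuclideanSpace ℝ (Fin d) → ℝ) =ᶠ[𝓝 v] fun _ => 0 := by
    filter_upwards [continuousAt_const.eventually_lt continuous_norm.continuousAt hv] with w hw
    exact ballCutoff_eq_zero hw.le
  rw [h1.lineDeriv_eq]
  simp [lineDeriv]

variable [NeZero d]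

/-- Integration by parts against the cutoff leaves no boundary term. The new weight, of size `(2j +
2) ‖v‖ ^ (2j + 1)` in the radial direction, concentrates on the sphere as `j` grows. The unit sphere
itself, where the cutoff has a kink, is null. -/
lemma integral_lineDeriv_mul_ballCutoff {g : EuclideanSpace ℝ (Fin d) → ℝ} {C : NNReal}
    (hg : LipschitzWith C g) (e : EuclideanSpace ℝ (Fin d)) (j : ℕ) :
    ∫ v, lineDeriv ℝ g v e * ballCutoff (2 * (j + 1)) v ∂(unifBall d) =
      ∫ v, (2 * j + 2) * ‖v‖ ^ (2 * j + 1) * (g v * ⟪‖v‖⁻¹ • v, e⟫) ∂(unifBall d) := by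
  rw [integral_unifBall, integral_unifBall]
  congr 1
  rw [setIntegral_eq_integral_of_forall_compl_eq_zero, hg.integral_lineDeriv_mul_eq
    (lipschitzWith_ballCutoff _) (hasCompactSupport_ballCutoff _),
    ← integral_indicator measurableSet_ball]
  · refine integral_congr_ae ?_
    have hs : ∀ᵐ v : EuclideanSpace ℝ (Fin d), v ∉ Metric.sphere (0 : EuclideanSpace ℝ (Fin d)) 1 :=
      measure_eq_zero_iff_ae_notMem.1 (Measure.addHaar_sphere _ _ _)
    filter_upwards [hs] with v hv
    rcases lt_trichotomy ‖v‖ 1 with h | h | h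
    · rw [lineDeriv_ballCutoff_of_norm_lt _ h, Set.indicator_of_mem (by simpa using h)]
      rcases eq_or_ne v 0 with rfl | h0
      · simp
      · have : ‖v‖ ≠ 0 := norm_ne_zero_iff.2 h0
        rw [inner_neg_right, real_inner_smul_left]
        field_simp
        ring
    · simp [h] at hv
    · rw [lineDeriv_ballCutoff_of_lt_norm _ h, Set.indicator_of_notMem (by simpa using h.le)]
      simp
  · intro v hv
    simp only [Metric.mem_ball, dist_zero_right, not_lt] at hv
    rw [ballCutoff_eq_zero hv, mul_zero]

lemma ae_unifBall_norm_lt : ∀ᵐ v ∂(unifBall d), ‖v‖ < 1 := by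
  have : ∀ᵐ v ∂((volume : Measure (EuclideanSpace ℝ (Fin d))).restrict
      (Metric.closedBall 0 1)), ‖v‖ < 1 := by
    rw [ae_restrict_iff' measurableSet_closedBall]
    have hs : ∀ᵐ v : EuclideanSpace ℝ (Fin d), v ∉ Metric.sphere (0 : EuclideanSpace ℝ (Fin d)) 1 :=
      measure_eq_zero_iff_ae_notMem.1 (Measure.addHaar_sphere _ _ _)
    filter_upwards [hs] with v hv hv'
    simp only [mem_sphere_iff_norm, sub_zero, Metric.mem_closedBall, dist_zero_right] at hv hv'
    exact lt_of_le_of_ne hv' hv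
  exact Measure.ae_smul_measure this _

/-- The mean over the unit ball of a product of a radial monomial and an angular function. -/
theorem integral_unifBall_norm_pow_mul (k : ℕ) (b : EuclideanSpace ℝ (Fin d) → ℝ) :
    ∫ v, ‖v‖ ^ k * b (‖v‖⁻¹ • v) ∂(unifBall d) =
      d / (d + k) * ∫ u, b (u : EuclideanSpace ℝ (Fin d)) ∂(unifSphere d) := by
  have h : ∀ c : EuclideanSpace ℝ (Fin d) → ℝ,
      ∫ v in Metric.ball (0 : EuclideanSpace ℝ (Fin d)) 1, ‖v‖ ^ k * c v =
        ∫ v, (Set.Iio (1 : ℝ)).indicator (fun r => r ^ k) ‖v‖ * c v := by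
    intro c
    rw [← integral_indicator measurableSet_ball]
    refine integral_congr_ae (.of_forall fun v => ?_)
    by_cases hv : ‖v‖ < 1 <;> simp [Set.indicator, hv]
  have h1 := integral_norm_pow_unifBall (d := d) k
  rw [integral_unifBall] at h1 ⊢
  rw [h (fun v => b (‖v‖⁻¹ • v)), integral_radial_mul_angular]
  have h2 := h (fun _ => 1)
  simp only [mul_one] at h2
  rw [← h2, ← h1]
  ring

/-- The divergence theorem on the unit ball for a Lipschitz function. -/
theorem integral_lineDeriv_unifBall {g : EuclideanSpace ℝ (Fin d) → ℝ} {C : NNReal}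
    (hg : LipschitzWith C g) (e : EuclideanSpace ℝ (Fin d)) :
    ∫ v, lineDeriv ℝ g v e ∂(unifBall d) =
      d * ∫ u, g (u : EuclideanSpace ℝ (Fin d)) * ⟪(u : EuclideanSpace ℝ (Fin d)), e⟫
        ∂(unifSphere d) := by
  set I := ∫ u, g (u : EuclideanSpace ℝ (Fin d)) * ⟪(u : EuclideanSpace ℝ (Fin d)), e⟫
        ∂(unifSphere d)
  have hd : (0 : ℝ) < d := Nat.cast_pos.2 (NeZero.pos d)
  have lim1 : Tendsto (fun j : ℕ =>
      ∫ v, lineDeriv ℝ g v e * ballCutoff (2 * (j + 1)) v ∂(unifBall d)) atTop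
      (𝓝 (∫ v, lineDeriv ℝ g v e ∂(unifBall d))) := by
    refine tendsto_integral_of_dominated_convergence (fun _ => C * ‖e‖) ?_ (integrable_const _) ?_ ?_
    · intro j
      exact ((measurable_lineDeriv hg.continuous).mul
        (lipschitzWith_ballCutoff _).continuous.measurable).aestronglyMeasurable
    · intro j
      refine .of_forall fun v => ?_
      rw [norm_mul, Real.norm_eq_abs (ballCutoff _ _)]
      calc _ ≤ (C * ‖e‖) * 1 := by
            gcongr
            · exact norm_lineDeriv_le_of_lipschitz ℝ hg
            · exact abs_ballCutoff_le _ _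
        _ = _ := mul_one _
    · filter_upwards [ae_unifBall_norm_lt] with v hv
      have h1 : Tendsto (fun j : ℕ => 1 - (‖v‖ ^ 2) ^ (j + 1)) atTop (𝓝 (1 - 0)) := by
        refine tendsto_const_nhds.sub ((tendsto_add_atTop_iff_nat 1).2 ?_)
        refine tendsto_pow_atTop_nhds_zero_of_lt_one (by positivity) ?_
        exact pow_lt_one₀ (norm_nonneg _) hv two_ne_zero
      have h2 := h1.const_mul (lineDeriv ℝ g v e)
      simp only [sub_zero, mul_one] at h2
      refine h2.congr fun j => ?_
      rw [ballCutoff_of_norm_le hv.le, pow_mul]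
  -- The total mass of the concentrating weight tends to `d`, which is the constant in front of the
  -- sphere integral.
  have lim2 : Tendsto (fun j : ℕ => (2 * (j : ℝ) + 2) * (d / (d + (2 * j + 1 : ℕ)))) atTop
      (𝓝 d) := by
    have h1 : Tendsto (fun j : ℕ => (d : ℝ) - d * (d - 1) * ((d : ℝ) + (2 * (j : ℝ) + 1))⁻¹) atTop
        (𝓝 (d - d * (d - 1) * 0)) := by
      refine tendsto_const_nhds.sub (Tendsto.const_mul _ (tendsto_inv_atTop_zero.comp ?_))
      refine tendsto_atTop_add_const_left _ _ (tendsto_atTop_add_const_right _ _ ?_)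
      exact tendsto_natCast_atTop_atTop.const_mul_atTop two_pos
    simp only [mul_zero, sub_zero] at h1
    refine h1.congr fun j => ?_
    have : (d : ℝ) + (2 * j + 1) ≠ 0 := by positivity
    push_cast
    field_simp
    ring
  -- Replacing `g v` by `g (v / ‖v‖)` costs at most `C (1 - ‖v‖)`. Integrated against the weight,
  -- this is a difference of two consecutive moments, of order `1 / j`.
  have lim3 : Tendsto (fun j : ℕ => C * ‖e‖ * ((2 * (j : ℝ) + 2) *
      (d / (d + (2 * j + 1 : ℕ)) - d / (d + (2 * j + 2 : ℕ))))) atTop (𝓝 0) := by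
    have h1 : Tendsto (fun j : ℕ => ((2 * (j : ℝ) + 2) * (d / (d + (2 * j + 1 : ℕ)))) *
        ((d : ℝ) + (2 * (j : ℝ) + 2))⁻¹) atTop (𝓝 (d * 0)) := by
      refine lim2.mul (tendsto_inv_atTop_zero.comp ?_)
      refine tendsto_atTop_add_const_left _ _ (tendsto_atTop_add_const_right _ _ ?_)
      exact tendsto_natCast_atTop_atTop.const_mul_atTop two_pos
    have h2 := h1.const_mul (C * ‖e‖)
    simp only [mul_zero] at h2
    refine h2.congr fun j => ?_
    have h3 : (d : ℝ) + (2 * j + 1) ≠ 0 := by positivity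
    have h4 : (d : ℝ) + (2 * j + 2) ≠ 0 := by positivity
    congr 1
    push_cast
    field_simp
    ring
  have hgm : Measurable g := hg.continuous.measurable
  have hbdd : ∀ v : EuclideanSpace ℝ (Fin d), ‖v‖ ≤ 1 → |g v| ≤ |g 0| + C := by
    intro v hv
    have := hg.dist_le_mul v 0
    rw [Real.dist_eq, dist_zero_right] at this
    have h2 : (C : ℝ) * ‖v‖ ≤ C * 1 := by gcongr
    have h3 := abs_sub_abs_le_abs_sub (g v) (g 0)
    linarith
  have hunit : ∀ v : EuclideanSpace ℝ (Fin d), ‖(‖v‖⁻¹ • v)‖ ≤ 1 := by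
    intro v
    rcases eq_or_ne v 0 with rfl | h0
    · simp
    · rw [norm_smul, norm_inv, norm_norm, inv_mul_cancel₀ (norm_ne_zero_iff.2 h0)]
  have hmeas_unit : Measurable fun v : EuclideanSpace ℝ (Fin d) => ‖v‖⁻¹ • v :=
    measurable_norm.inv.smul measurable_id
  -- Used with `q` the identity and with `q` the normalization, the two integrands compared in
  -- `hdiff`.
  have hint : ∀ (q : EuclideanSpace ℝ (Fin d) → EuclideanSpace ℝ (Fin d)), Measurable q →
      (∀ v, ‖v‖ ≤ 1 → ‖q v‖ ≤ 1) → ∀ k : ℕ,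
      Integrable (fun v => ‖v‖ ^ k * (g (q v) * ⟪‖v‖⁻¹ • v, e⟫)) (unifBall d) := by
    intro q hq hq1 k
    refine Integrable.of_bound (C := 1 * ((|g 0| + C) * (1 * ‖e‖))) ?_ ?_
    · exact ((measurable_norm.pow_const k).mul
        ((hgm.comp hq).mul (hmeas_unit.inner measurable_const))).aestronglyMeasurable
    · filter_upwards [ae_unifBall_norm_lt] with v hv
      rw [norm_mul, norm_mul, norm_pow, norm_norm]
      gcongr
      · exact pow_le_one₀ (norm_nonneg _) hv.le
      · exact hbdd _ (hq1 _ hv.le)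
      · exact (norm_inner_le_norm _ _).trans (by gcongr; exact hunit v)
  have hpow : ∀ k : ℕ, Integrable (fun v : EuclideanSpace ℝ (Fin d) => ‖v‖ ^ k) (unifBall d) := by
    intro k
    refine Integrable.of_bound (C := 1) (measurable_norm.pow_const k).aestronglyMeasurable ?_
    filter_upwards [ae_unifBall_norm_lt] with v hv
    rw [norm_pow, norm_norm]
    exact pow_le_one₀ (norm_nonneg _) hv.le
  have hdiff : ∀ j : ℕ, ‖∫ v, lineDeriv ℝ g v e * ballCutoff (2 * (j + 1)) v ∂(unifBall d) -
      (2 * (j : ℝ) + 2) * (d / (d + (2 * j + 1 : ℕ))) * I‖ ≤ C * ‖e‖ * ((2 * (j : ℝ) + 2) *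
      (d / (d + (2 * j + 1 : ℕ)) - d / (d + (2 * j + 2 : ℕ)))) := by
    intro j
    rw [integral_lineDeriv_mul_ballCutoff hg, ← integral_norm_pow_unifBall (2 * j + 2)]
    have h1 := integral_unifBall_norm_pow_mul (2 * j + 1) (fun u => g u * ⟪u, e⟫)
    rw [mul_assoc (2 * (j : ℝ) + 2), ← h1]
    simp_rw [mul_assoc (2 * (j : ℝ) + 2)]
    have hint1 : Integrable (fun v => ‖v‖ ^ (2 * j + 1) * (g v * ⟪‖v‖⁻¹ • v, e⟫)) (unifBall d) :=
      hint id measurable_id (fun _ h => h) _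
    rw [integral_const_mul, ← mul_sub, ← integral_sub hint1
      (hint _ hmeas_unit (fun v _ => hunit v) _), norm_mul, Real.norm_of_nonneg (by positivity),
      mul_left_comm]
    gcongr
    rw [← integral_norm_pow_unifBall (2 * j + 1), ← integral_sub (hpow _) (hpow _),
      ← integral_const_mul]
    refine norm_integral_le_of_norm_le (((hpow _).sub (hpow _)).const_mul _) ?_
    filter_upwards [ae_unifBall_norm_lt] with v hv
    rw [← mul_sub, ← sub_mul, norm_mul, norm_mul, norm_pow, norm_norm]
    have h3 : ‖g v - g (‖v‖⁻¹ • v)‖ * ‖v‖ ≤ C * (1 - ‖v‖) * ‖v‖ := by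
      rcases eq_or_ne v 0 with rfl | h0
      · simp
      have h4 := hg.dist_le_mul v (‖v‖⁻¹ • v)
      rw [Real.dist_eq, dist_eq_norm] at h4
      have h5 : ‖v - ‖v‖⁻¹ • v‖ = 1 - ‖v‖ := by
        have hv0 : 0 < ‖v‖ := norm_pos_iff.2 h0
        have h6 : v - ‖v‖⁻¹ • v = (1 - ‖v‖⁻¹) • v := by rw [sub_smul, one_smul]
        rw [h6, norm_smul, Real.norm_of_nonpos (by
          rw [sub_nonpos]; exact (one_le_inv₀ hv0).2 hv.le)]
        field_simp
        ring
      rw [h5] at h4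
      gcongr
      exact h4
    have h7 : ‖⟪‖v‖⁻¹ • v, e⟫‖ ≤ ‖e‖ :=
      (norm_inner_le_norm _ _).trans (mul_le_of_le_one_left (norm_nonneg _) (hunit v))
    calc _ = ‖v‖ ^ (2 * j) * (‖g v - g (‖v‖⁻¹ • v)‖ * ‖v‖) * ‖⟪‖v‖⁻¹ • v, e⟫‖ := by ring
      _ ≤ ‖v‖ ^ (2 * j) * (C * (1 - ‖v‖) * ‖v‖) * ‖e‖ := by
          gcongr
      _ = _ := by ring
  have lim4 := (squeeze_zero_norm hdiff lim3).add (lim2.mul_const I)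
  simp only [sub_add_cancel, zero_add] at lim4
  exact tendsto_nhds_unique lim1 lim4

end Divergence

/-! ### The gradient of the smoothed function -/

section Gradient

open scoped RealInnerProductSpace Topology
open Filter

variable {d : ℕ}

lemma unifBall_absolutelyContinuous :
    unifBall d ≪ (volume : Measure (EuclideanSpace ℝ (Fin d))) :=
  Measure.AbsolutelyContinuous.smul_left Measure.absolutelyContinuous_restrict _

lemma lipschitzWith_comp_add_smul {f : EuclideanSpace ℝ (Fin d) → ℝ} {C : NNReal}
    (hf : LipschitzWith C f) (δ : ℝ) (x : EuclideanSpace ℝ (Fin d)) :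
    LipschitzWith (C * ‖δ‖₊) fun v => f (x + δ • v) := by
  refine hf.comp (LipschitzWith.of_dist_le_mul fun v w => ?_)
  rw [dist_add_left, dist_smul₀, coe_nnnorm]

variable [NeZero d]

lemma integrable_unifSphere_of_continuous {G : Type*} [NormedAddCommGroup G]
    {h : Metric.sphere (0 : EuclideanSpace ℝ (Fin d)) 1 → G} (hh : Continuous h) :
    Integrable h (unifSphere d) :=
  (integrableOn_univ (μ := unifSphere d)).1 (hh.continuousOn.integrableOn_compact isCompact_univ)

/-- Differentiation under the integral sign for the smoothed function. -/
lemma hasFDerivAt_smoothed {f : EuclideanSpace ℝ (Fin d) → ℝ} {C : NNReal}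
    (hf : LipschitzWith C f) {δ : ℝ} (hδ : 0 < δ) (x : EuclideanSpace ℝ (Fin d)) :
    Integrable (fun v => δ⁻¹ • fderiv ℝ (fun w => f (x + δ • w)) v) (unifBall d) ∧
    HasFDerivAt (smoothed δ f)
      (∫ v, δ⁻¹ • fderiv ℝ (fun w => f (x + δ • w)) v ∂(unifBall d)) x := by
  have hg := lipschitzWith_comp_add_smul hf δ x
  have hgd : ∀ᵐ v ∂(unifBall d), DifferentiableAt ℝ (fun w => f (x + δ • w)) v :=
    unifBall_absolutelyContinuous.ae_le hg.ae_differentiableAt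
  have hmeas : ∀ x' : EuclideanSpace ℝ (Fin d),
      AEStronglyMeasurable (fun v => f (x' + δ • v)) (unifBall d) := fun x' =>
    (lipschitzWith_comp_add_smul hf δ x').continuous.aestronglyMeasurable
  have hint : Integrable (fun v => f (x + δ • v)) (unifBall d) := by
    refine Integrable.of_bound (C := |f x| + C * δ) (hmeas x) ?_
    filter_upwards [ae_unifBall_norm_lt] with v hv
    have h1 := hf.dist_le_mul (x + δ • v) x
    rw [Real.dist_eq, dist_self_add_left, norm_smul, Real.norm_of_nonneg hδ.le] at h1
    have h2 := abs_sub_abs_le_abs_sub (f (x + δ • v)) (f x)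
    have h3 : (C : ℝ) * (δ * ‖v‖) ≤ C * (δ * 1) := by gcongr
    rw [Real.norm_eq_abs]
    linarith
  have hmeas' : AEStronglyMeasurable (fun v => δ⁻¹ • fderiv ℝ (fun w => f (x + δ • w)) v)
      (unifBall d) :=
    ((measurable_fderiv ℝ fun w => f (x + δ • w)).const_smul δ⁻¹).aestronglyMeasurable
  have hlip : ∀ᵐ v ∂(unifBall d), ∀ x' ∈ (Set.univ : Set (EuclideanSpace ℝ (Fin d))),
      ‖f (x' + δ • v) - f (x + δ • v)‖ ≤ (C : ℝ) * ‖x' - x‖ := by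
    refine .of_forall fun v x' _ => ?_
    have := hf.dist_le_mul (x' + δ • v) (x + δ • v)
    rwa [dist_add_right, dist_eq_norm, dist_eq_norm] at this
  -- Rademacher is applied in `v` at fixed `x`. Writing `x' + δ v = x + δ (v + δ⁻¹ (x' - x))`
  -- transfers differentiability in `v` to differentiability in `x'` at `x`, so every `x` is
  -- covered.
  have hdiff : ∀ᵐ v ∂(unifBall d), HasFDerivAt (fun x' => f (x' + δ • v))
      (δ⁻¹ • fderiv ℝ (fun w => f (x + δ • w)) v) x := by
    filter_upwards [hgd] with v hv
    have h1 : HasFDerivAt (fun x' : EuclideanSpace ℝ (Fin d) => v + δ⁻¹ • (x' - x))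
        (δ⁻¹ • ContinuousLinearMap.id ℝ _) x :=
      (((hasFDerivAt_id x).sub_const x).const_smul δ⁻¹).const_add v
    have h2 : HasFDerivAt (fun w => f (x + δ • w)) (fderiv ℝ (fun w => f (x + δ • w)) v)
        (v + δ⁻¹ • (x - x)) := by
      rw [sub_self, smul_zero, add_zero]
      exact hv.hasFDerivAt
    have h3 := h2.comp x h1
    have h4 : (fun w => f (x + δ • w)) ∘
        (fun x' : EuclideanSpace ℝ (Fin d) => v + δ⁻¹ • (x' - x)) =
        fun x' => f (x' + δ • v) := by
      ext x'
      simp only [Function.comp_apply, smul_add, smul_smul, mul_inv_cancel₀ hδ.ne', one_smul]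
      congr 1
      abel
    rw [h4, ContinuousLinearMap.comp_smul, ContinuousLinearMap.comp_id] at h3
    exact h3
  exact hasFDerivAt_integral_of_dominated_loc_of_lip' univ_mem (fun x' _ => hmeas x') hint hmeas'
    hlip (integrable_const _) hdiff

/-- The smoothed function of a Lipschitz function is differentiable, and its gradient is a mean
over the sphere. -/
theorem hasGradientAt_smoothed {f : EuclideanSpace ℝ (Fin d) → ℝ} {C : NNReal}
    (hf : LipschitzWith C f) {δ : ℝ} (hδ : 0 < δ) (x : EuclideanSpace ℝ (Fin d)) :
    HasGradientAt (smoothed δ f)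
      ((d / δ) • ∫ u, f (x + δ • (u : EuclideanSpace ℝ (Fin d))) • (u : EuclideanSpace ℝ (Fin d))
        ∂(unifSphere d)) x := by
  have hg := lipschitzWith_comp_add_smul hf δ x
  have hgd : ∀ᵐ v ∂(unifBall d), DifferentiableAt ℝ (fun w => f (x + δ • w)) v :=
    unifBall_absolutelyContinuous.ae_le hg.ae_differentiableAt
  obtain ⟨hint, hder⟩ := hasFDerivAt_smoothed hf hδ x
  rw [hasGradientAt_iff_hasFDerivAt]
  refine hder.congr_fderiv ?_
  ext e
  have hcont : Continuous fun u : Metric.sphere (0 : EuclideanSpace ℝ (Fin d)) 1 =>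
      f (x + δ • (u : EuclideanSpace ℝ (Fin d))) • (u : EuclideanSpace ℝ (Fin d)) :=
    (hf.continuous.comp (by fun_prop)).smul continuous_subtype_val
  rw [ContinuousLinearMap.integral_apply hint, InnerProductSpace.toDual_apply_apply,
    real_inner_smul_left, real_inner_comm, ← integral_inner
      (integrable_unifSphere_of_continuous hcont)]
  have h5 : ∫ v, (δ⁻¹ • fderiv ℝ (fun w => f (x + δ • w)) v) e ∂(unifBall d) =
      δ⁻¹ * ∫ v, lineDeriv ℝ (fun w => f (x + δ • w)) v e ∂(unifBall d) := by
    rw [← integral_const_mul]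
    refine integral_congr_ae ?_
    filter_upwards [hgd] with v hv
    rw [hv.lineDeriv_eq_fderiv]
    rfl
  rw [h5, integral_lineDeriv_unifBall hg, ← mul_assoc, div_eq_inv_mul]
  congr 1
  refine integral_congr_ae (.of_forall fun u => ?_)
  simp only [real_inner_smul_right]
  rw [real_inner_comm]

/-- The gradient of the smoothed function as a mean of symmetric differences. -/
theorem gradient_smoothed {f : EuclideanSpace ℝ (Fin d) → ℝ} {C : NNReal}
    (hf : LipschitzWith C f) {δ : ℝ} (hδ : 0 < δ) (x : EuclideanSpace ℝ (Fin d)) :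
    gradient (smoothed δ f) x =
      ∫ u, ((d / (2 * δ)) * (f (x + δ • (u : EuclideanSpace ℝ (Fin d))) -
        f (x - δ • (u : EuclideanSpace ℝ (Fin d))))) • (u : EuclideanSpace ℝ (Fin d))
        ∂(unifSphere d) := by
  rw [(hasGradientAt_smoothed hf hδ x).gradient]
  have hp : Continuous fun u : Metric.sphere (0 : EuclideanSpace ℝ (Fin d)) 1 =>
      f (x + δ • (u : EuclideanSpace ℝ (Fin d))) • (u : EuclideanSpace ℝ (Fin d)) :=
    (hf.continuous.comp (by fun_prop)).smul continuous_subtype_val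
  have hm : Continuous fun u : Metric.sphere (0 : EuclideanSpace ℝ (Fin d)) 1 =>
      f (x - δ • (u : EuclideanSpace ℝ (Fin d))) • (u : EuclideanSpace ℝ (Fin d)) :=
    (hf.continuous.comp (by fun_prop)).smul continuous_subtype_val
  have hip := integrable_unifSphere_of_continuous hp
  have him := integrable_unifSphere_of_continuous hm
  -- `integral_unifSphere_neg` concerns real functions, so the vector identity is tested against
  -- every `e`.
  have hneg : ∫ u, f (x - δ • (u : EuclideanSpace ℝ (Fin d))) • (u : EuclideanSpace ℝ (Fin d))
      ∂(unifSphere d) = -∫ u, f (x + δ • (u : EuclideanSpace ℝ (Fin d))) •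
        (u : EuclideanSpace ℝ (Fin d)) ∂(unifSphere d) := by
    refine ext_inner_left ℝ fun e => ?_
    rw [inner_neg_right, ← integral_inner him, ← integral_inner hip]
    have := integral_unifSphere_neg
      (fun u : EuclideanSpace ℝ (Fin d) => ⟪e, f (x + δ • u) • u⟫)
    rw [← this, ← integral_neg]
    refine integral_congr_ae (.of_forall fun u => ?_)
    simp [sub_eq_add_neg]
  simp_rw [mul_smul, sub_smul]
  rw [integral_smul, integral_sub hip him, hneg, sub_neg_eq_add, ← two_smul ℝ, smul_smul]
  congr 1
  field_simp

end Gradient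

/-! ### A Poincaré inequality for odd Lipschitz functions on the sphere -/

section Gaussian

open scoped RealInnerProductSpace Topology
open Filter

variable {d : ℕ}

/-- The standard Gaussian measure has density proportional to `exp (-‖x‖² / 2)`. -/
theorem stdGaussian_eq_withDensity :
    stdGaussian (EuclideanSpace ℝ (Fin d)) = volume.withDensity fun x =>
      ENNReal.ofReal ((∫ v : EuclideanSpace ℝ (Fin d), Real.exp (-(1 / 2) * ‖v‖ ^ 2))⁻¹ *
        Real.exp (-(1 / 2) * ‖x‖ ^ 2)) := by
  set Z := ∫ v : EuclideanSpace ℝ (Fin d), Real.exp (-(1 / 2) * ‖v‖ ^ 2) with hZ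
  have hhalf : (0 : ℝ) < 1 / 2 := by norm_num
  have hint : Integrable fun v : EuclideanSpace ℝ (Fin d) => Real.exp (-(1 / 2) * ‖v‖ ^ 2) := by
    have := (GaussianFourier.integrable_cexp_neg_mul_sq_norm_add
      (V := EuclideanSpace ℝ (Fin d)) (b := ((1 / 2 : ℝ) : ℂ)) (by simp) 0 0).norm
    refine this.congr (.of_forall fun v => ?_)
    simp [Complex.norm_exp, ← Complex.ofReal_pow]
  have hZpos : 0 < Z := integral_exp_pos hint
  have hZc : (Z : ℂ) = (Real.pi / ((1 / 2 : ℝ) : ℂ)) ^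
      (Module.finrank ℝ (EuclideanSpace ℝ (Fin d)) / 2 : ℂ) := by
    rw [← GaussianFourier.integral_cexp_neg_mul_sq_norm (V := EuclideanSpace ℝ (Fin d))
      (b := ((1 / 2 : ℝ) : ℂ)) (by simp), hZ, ← integral_complex_ofReal]
    simp
  have hfin : IsFiniteMeasure ((volume : Measure (EuclideanSpace ℝ (Fin d))).withDensity fun x =>
      ENNReal.ofReal (Z⁻¹ * Real.exp (-(1 / 2) * ‖x‖ ^ 2))) :=
    isFiniteMeasure_withDensity_ofReal (hint.const_mul _).2
  -- The Fourier transform of the density produces the same power of `π / (1/2)` as `hZc`, so the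
  -- normalization cancels.
  refine Measure.ext_of_charFun (funext fun t => ?_)
  rw [charFun_stdGaussian, charFun_apply, integral_withDensity_eq_integral_toReal_smul
    (by fun_prop) (.of_forall fun _ => ENNReal.ofReal_lt_top)]
  have h1 := GaussianFourier.integral_cexp_neg_mul_sq_norm_add (V := EuclideanSpace ℝ (Fin d))
    (b := ((1 / 2 : ℝ) : ℂ)) (by simp) Complex.I t
  rw [← hZc] at h1
  have h2 : ∀ x : EuclideanSpace ℝ (Fin d),
      (ENNReal.ofReal (Z⁻¹ * Real.exp (-(1 / 2) * ‖x‖ ^ 2))).toReal •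
        Complex.exp (⟪x, t⟫ * Complex.I) =
      (Z : ℂ)⁻¹ * Complex.exp (-((1 / 2 : ℝ) : ℂ) * ‖x‖ ^ 2 + Complex.I * ⟪t, x⟫) := by
    intro x
    rw [ENNReal.toReal_ofReal (by positivity), Complex.real_smul, Complex.exp_add,
      real_inner_comm, mul_comm Complex.I]
    push_cast
    ring
  simp_rw [h2]
  rw [integral_const_mul, h1, ← mul_assoc, inv_mul_cancel₀ (by exact_mod_cast hZpos.ne'), one_mul,
    Complex.I_sq]
  congr 1
  push_cast
  ring

lemma stdGaussian_absolutelyContinuous :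
    stdGaussian (EuclideanSpace ℝ (Fin d)) ≪ volume := by
  rw [stdGaussian_eq_withDensity]
  exact withDensity_absolutelyContinuous _ _

/-- Polar coordinates for the standard Gaussian measure. -/
theorem integral_stdGaussian_radial_mul_angular [NeZero d] (a : ℝ → ℝ)
    (b : EuclideanSpace ℝ (Fin d) → ℝ) :
    ∫ x, a ‖x‖ * b (‖x‖⁻¹ • x) ∂(stdGaussian (EuclideanSpace ℝ (Fin d))) =
      (∫ u, b (u : EuclideanSpace ℝ (Fin d)) ∂(unifSphere d)) *
        ∫ x, a ‖x‖ ∂(stdGaussian (EuclideanSpace ℝ (Fin d))) := by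
  rw [stdGaussian_eq_withDensity]
  set Z := ∫ v : EuclideanSpace ℝ (Fin d), Real.exp (-(1 / 2) * ‖v‖ ^ 2)
  rw [integral_withDensity_eq_integral_toReal_smul (by fun_prop)
    (.of_forall fun _ => ENNReal.ofReal_lt_top), integral_withDensity_eq_integral_toReal_smul
    (by fun_prop) (.of_forall fun _ => ENNReal.ofReal_lt_top)]
  -- The Gaussian density is radial, so it is absorbed into the radial factor.
  have h := integral_radial_mul_angular
    (fun r => (ENNReal.ofReal (Z⁻¹ * Real.exp (-(1 / 2) * r ^ 2))).toReal * a r) b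
  simp only [smul_eq_mul, ← mul_assoc] at h ⊢
  exact h

lemma integral_sq_strongDual_stdGaussian (ℓ : StrongDual ℝ (EuclideanSpace ℝ (Fin d))) :
    ∫ x, ℓ x ^ 2 ∂(stdGaussian (EuclideanSpace ℝ (Fin d))) = ‖ℓ‖ ^ 2 := by
  rw [← variance_dual_stdGaussian, variance_of_integral_eq_zero ℓ.continuous.aemeasurable
    (integral_strongDual_stdGaussian ℓ)]

lemma integral_norm_sq_stdGaussian :
    ∫ x, ‖x‖ ^ 2 ∂(stdGaussian (EuclideanSpace ℝ (Fin d))) = d := by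
  have h1 : ∀ x : EuclideanSpace ℝ (Fin d),
      ‖x‖ ^ 2 = ∑ i, (innerSL ℝ (EuclideanSpace.basisFun (Fin d) ℝ i) x) ^ 2 := by
    intro x
    rw [EuclideanSpace.real_norm_sq_eq]
    simp [EuclideanSpace.inner_single_left]
  simp_rw [h1]
  rw [integral_finsetSum]
  · simp_rw [integral_sq_strongDual_stdGaussian]
    simp
  · intro i _
    exact (IsGaussian.memLp_dual (stdGaussian (EuclideanSpace ℝ (Fin d))) _ 2
      (by simp)).integrable_sq

/-- The points `cos θ x + sin θ y`, for `θ = kπ/n`, lead from `x` to `-x`. By oddness the increments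
of `H` telescope to `2 H x`, and Cauchy–Schwarz gives the factor `n`. Each increment is the first
one evaluated at a rotated pair. -/
lemma sq_le_of_rotation_steps {H : EuclideanSpace ℝ (Fin d) → ℝ} (hodd : ∀ x, H (-x) = -H x)
    {n : ℕ} (hn : n ≠ 0) (p : EuclideanSpace ℝ (Fin d) × EuclideanSpace ℝ (Fin d)) :
    4 * H p.1 ^ 2 ≤ n * ∑ k ∈ Finset.range n,
      (fun q : EuclideanSpace ℝ (Fin d) × EuclideanSpace ℝ (Fin d) =>
        (H q.1 - H (Real.cos (Real.pi / n) • q.1 + Real.sin (Real.pi / n) • q.2)) ^ 2)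
      (ContinuousLinearMap.rotation (k * (Real.pi / n)) p) := by
  set c : ℕ → ℝ := fun k => H (Real.cos (k * (Real.pi / n)) • p.1 +
    Real.sin (k * (Real.pi / n)) • p.2) with hc
  have hstep : ∀ k : ℕ, (fun q : EuclideanSpace ℝ (Fin d) × EuclideanSpace ℝ (Fin d) =>
        (H q.1 - H (Real.cos (Real.pi / n) • q.1 + Real.sin (Real.pi / n) • q.2)) ^ 2)
      (ContinuousLinearMap.rotation (k * (Real.pi / n)) p) = (c k - c (k + 1)) ^ 2 := by
    intro k
    simp only [ContinuousLinearMap.rotation_apply, hc]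
    have : ((k + 1 : ℕ) : ℝ) * (Real.pi / n) = k * (Real.pi / n) + Real.pi / n := by
      push_cast; ring
    rw [this, Real.cos_add, Real.sin_add]
    congr 3
    module
  simp_rw [hstep]
  have htel : ∑ k ∈ Finset.range n, (c k - c (k + 1)) = 2 * H p.1 := by
    rw [Finset.sum_range_sub']
    have : (n : ℝ) * (Real.pi / n) = Real.pi := by field_simp
    simp only [hc, this]
    simp [hodd]
    ring
  have := sq_sum_le_card_mul_sum_sq (s := Finset.range n) (f := fun k => c k - c (k + 1))
  rw [htel, Finset.card_range] at this
  linarith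

lemma integrable_add_norm_sq_stdGaussian :
    Integrable (fun p : EuclideanSpace ℝ (Fin d) × EuclideanSpace ℝ (Fin d) =>
      (‖p.1‖ + ‖p.2‖) ^ 2)
      ((stdGaussian (EuclideanSpace ℝ (Fin d))).prod (stdGaussian (EuclideanSpace ℝ (Fin d)))) := by
  have h := (IsGaussian.memLp_id (stdGaussian (EuclideanSpace ℝ (Fin d))) 2 (by simp)).norm
  exact ((h.comp_fst _).add (h.comp_snd _)).integrable_sq

/-- Linearity in `θ` is what matters: with `θ = π / n`, the increment multiplied by `n` stays
dominated uniformly in `n`. -/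
lemma abs_sub_rotate_le {H : EuclideanSpace ℝ (Fin d) → ℝ} {K : NNReal} (hH : LipschitzWith K H)
    {θ : ℝ} (hθ : 0 ≤ θ) (x y : EuclideanSpace ℝ (Fin d)) :
    |H x - H (Real.cos θ • x + Real.sin θ • y)| ≤ K * (θ * (‖x‖ + ‖y‖)) := by
  have h := hH.dist_le_mul x (Real.cos θ • x + Real.sin θ • y)
  rw [Real.dist_eq, dist_eq_norm] at h
  refine h.trans ?_
  gcongr
  have h1 : x - (Real.cos θ • x + Real.sin θ • y) = (1 - Real.cos θ) • x - Real.sin θ • y := by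
    module
  have h2 : |1 - Real.cos θ| ≤ θ := by
    have := Real.abs_cos_sub_cos_le 0 θ
    simpa [abs_of_nonneg hθ] using this
  have h3 : |Real.sin θ| ≤ θ := by
    simpa [abs_of_nonneg hθ] using Real.abs_sin_le_abs (x := θ)
  rw [h1]
  calc _ ≤ ‖(1 - Real.cos θ) • x‖ + ‖Real.sin θ • y‖ := norm_sub_le _ _
    _ = |1 - Real.cos θ| * ‖x‖ + |Real.sin θ| * ‖y‖ := by simp [norm_smul]
    _ ≤ θ * ‖x‖ + θ * ‖y‖ := by gcongr
    _ = _ := by ring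

/-- Rotations preserve the product Gaussian, so the `n` increments have equal mean squares. Together
with the factor from Cauchy–Schwarz this is `n²`, which moves inside the square. -/
lemma integral_sq_le_rotation {H : EuclideanSpace ℝ (Fin d) → ℝ} {K : NNReal}
    (hH : LipschitzWith K H) (hodd : ∀ x, H (-x) = -H x) {n : ℕ} (hn : n ≠ 0) :
    4 * ∫ x, H x ^ 2 ∂(stdGaussian (EuclideanSpace ℝ (Fin d))) ≤
      ∫ p, ((n : ℝ) * (H p.1 - H (Real.cos (Real.pi / n) • p.1 + Real.sin (Real.pi / n) • p.2))) ^ 2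
        ∂((stdGaussian (EuclideanSpace ℝ (Fin d))).prod
          (stdGaussian (EuclideanSpace ℝ (Fin d)))) := by
  set γ := stdGaussian (EuclideanSpace ℝ (Fin d)) with hγ
  set D : EuclideanSpace ℝ (Fin d) × EuclideanSpace ℝ (Fin d) → ℝ := fun q =>
    (H q.1 - H (Real.cos (Real.pi / n) • q.1 + Real.sin (Real.pi / n) • q.2)) ^ 2 with hD
  have hDc : Continuous D := by
    have := hH.continuous
    fun_prop
  have hDi : Integrable D (γ.prod γ) := by
    refine (integrable_add_norm_sq_stdGaussian.const_mul ((K * (Real.pi / n)) ^ 2)).mono'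
      hDc.aestronglyMeasurable (.of_forall fun p => ?_)
    have h := abs_sub_rotate_le hH (θ := Real.pi / n) (by positivity) p.1 p.2
    rw [Real.norm_of_nonneg (sq_nonneg _), ← mul_pow, ← sq_abs]
    gcongr
    linarith
  have hrot : ∀ θ : ℝ, MeasurePreserving (ContinuousLinearMap.rotation θ) (γ.prod γ) (γ.prod γ) :=
    fun θ => ⟨(ContinuousLinearMap.rotation θ).continuous.measurable,
      IsGaussian.map_rotation_eq_self (by simpa using integral_id_stdGaussian) θ⟩
  have hDr : ∀ θ : ℝ, Integrable (fun p => D (ContinuousLinearMap.rotation θ p)) (γ.prod γ) :=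
    fun θ => (hrot θ).integrable_comp_of_integrable hDi
  have hDr' : ∀ θ : ℝ, ∫ p, D (ContinuousLinearMap.rotation θ p) ∂(γ.prod γ) =
      ∫ p, D p ∂(γ.prod γ) := by
    intro θ
    conv_rhs => rw [← (hrot θ).map_eq]
    rw [integral_map (hrot θ).measurable.aemeasurable hDc.aestronglyMeasurable]
  have hfst : ∫ x, H x ^ 2 ∂γ = ∫ p, H p.1 ^ 2 ∂(γ.prod γ) := by
    rw [integral_fun_fst (fun x => H x ^ 2)]
    simp
  calc 4 * ∫ x, H x ^ 2 ∂γ = ∫ p, 4 * H p.1 ^ 2 ∂(γ.prod γ) := by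
        rw [hfst, integral_const_mul]
    _ ≤ ∫ p, n * ∑ k ∈ Finset.range n,
          D (ContinuousLinearMap.rotation (k * (Real.pi / n)) p) ∂(γ.prod γ) := by
        refine integral_mono_of_nonneg (.of_forall fun p => by positivity)
          ((integrable_finsetSum _ fun k _ => hDr _).const_mul _)
          (.of_forall fun p => sq_le_of_rotation_steps hodd hn p)
    _ = n * (n * ∫ p, D p ∂(γ.prod γ)) := by
        rw [integral_const_mul, integral_finsetSum _ fun k _ => hDr _]
        simp [hDr']
    _ = _ := by
        simp_rw [mul_pow]
        rw [integral_const_mul]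
        ring

/-- A Gaussian Poincaré inequality for odd Lipschitz functions. -/
theorem integral_sq_stdGaussian_le_of_odd {H : EuclideanSpace ℝ (Fin d) → ℝ} {K : NNReal}
    (hH : LipschitzWith K H) (hodd : ∀ x, H (-x) = -H x) :
    4 * ∫ x, H x ^ 2 ∂(stdGaussian (EuclideanSpace ℝ (Fin d))) ≤ Real.pi ^ 2 * K ^ 2 := by
  set γ := stdGaussian (EuclideanSpace ℝ (Fin d)) with hγ
  have hcont := hH.continuous
  have hder : Measurable fun p : EuclideanSpace ℝ (Fin d) × EuclideanSpace ℝ (Fin d) =>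
      fderiv ℝ H p.1 p.2 :=
    (isBoundedBilinearMap_apply (𝕜 := ℝ) (E := EuclideanSpace ℝ (Fin d))
      (F := ℝ)).continuous.measurable.comp
      (((measurable_fderiv ℝ H).comp measurable_fst).prodMk measurable_snd)
  -- As `n → ∞` the scaled first increment becomes `π` times a derivative at angle `0`, up to sign.
  -- Only differentiability of `H` at `p.1` is needed, and it holds almost everywhere.
  have hlim : Tendsto (fun n : ℕ => ∫ p, ((n : ℝ) *
      (H p.1 - H (Real.cos (Real.pi / n) • p.1 + Real.sin (Real.pi / n) • p.2))) ^ 2 ∂(γ.prod γ))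
      atTop (𝓝 (∫ p, (Real.pi * fderiv ℝ H p.1 p.2) ^ 2 ∂(γ.prod γ))) := by
    refine tendsto_integral_of_dominated_convergence
      (fun p => (K * Real.pi) ^ 2 * (‖p.1‖ + ‖p.2‖) ^ 2)
      (fun n => Continuous.aestronglyMeasurable (by fun_prop))
      (integrable_add_norm_sq_stdGaussian.const_mul _) (fun n => .of_forall fun p => ?_) ?_
    · rw [Real.norm_of_nonneg (sq_nonneg _), ← mul_pow, ← sq_abs]
      gcongr
      rw [abs_mul, Nat.abs_cast]
      rcases eq_or_ne n 0 with rfl | hn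
      · simp only [CharP.cast_eq_zero, zero_mul]
        positivity
      have h := abs_sub_rotate_le hH (θ := Real.pi / n) (by positivity) p.1 p.2
      calc _ ≤ n * (K * (Real.pi / n * (‖p.1‖ + ‖p.2‖))) := by gcongr
        _ = _ := by field_simp
    · have hae : ∀ᵐ p ∂(γ.prod γ), DifferentiableAt ℝ H p.1 :=
        Measure.quasiMeasurePreserving_fst.ae
          (stdGaussian_absolutelyContinuous.ae_le hH.ae_differentiableAt)
      filter_upwards [hae] with p hp
      have h1 : HasDerivAt (fun t : ℝ => Real.cos t • p.1 + Real.sin t • p.2) p.2 0 := by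
        refine (((Real.hasDerivAt_cos 0).smul_const p.1).add
          ((Real.hasDerivAt_sin 0).smul_const p.2)).congr_deriv ?_
        simp
      have h2 : HasDerivAt (fun t : ℝ => H (Real.cos t • p.1 + Real.sin t • p.2))
          (fderiv ℝ H p.1 p.2) 0 := by
        refine HasFDerivAt.comp_hasDerivAt (0 : ℝ) ?_ h1
        simpa using hp.hasFDerivAt
      have h3 : Tendsto (fun n : ℕ => Real.pi / n) atTop (𝓝[≠] 0) := by
        refine tendsto_nhdsWithin_iff.2 ⟨tendsto_const_div_atTop_nhds_zero_nat _, ?_⟩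
        filter_upwards [eventually_ne_atTop 0] with n hn
        exact div_ne_zero Real.pi_ne_zero (Nat.cast_ne_zero.2 hn)
      have h4 := ((h2.tendsto_slope_zero.comp h3).const_mul Real.pi).pow 2
      refine h4.congr fun n => ?_
      simp only [Function.comp_apply, zero_add, Real.cos_zero, Real.sin_zero, one_smul, zero_smul,
        add_zero, smul_eq_mul, inv_div]
      rw [← mul_assoc, mul_div_cancel₀ _ Real.pi_ne_zero]
      ring
  have hle : ∫ p, (Real.pi * fderiv ℝ H p.1 p.2) ^ 2 ∂(γ.prod γ) ≤ Real.pi ^ 2 * K ^ 2 := by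
    have hint : Integrable (fun p : EuclideanSpace ℝ (Fin d) × EuclideanSpace ℝ (Fin d) =>
        (fderiv ℝ H p.1 p.2) ^ 2) (γ.prod γ) := by
      refine (integrable_add_norm_sq_stdGaussian.const_mul ((K : ℝ) ^ 2)).mono'
        (hder.pow_const 2).aestronglyMeasurable (.of_forall fun p => ?_)
      rw [Real.norm_of_nonneg (sq_nonneg _), ← mul_pow, ← sq_abs]
      gcongr
      refine ((fderiv ℝ H p.1).le_opNorm p.2).trans ?_
      gcongr
      · exact norm_fderiv_le_of_lipschitz ℝ hH
      · linarith [norm_nonneg p.1]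
    simp_rw [mul_pow]
    rw [integral_const_mul]
    gcongr
    -- With `p.1` fixed, the inner integral is the Gaussian second moment of a linear functional,
    -- its squared norm.
    rw [integral_prod _ hint]
    simp_rw [hγ, integral_sq_strongDual_stdGaussian]
    refine (integral_mono_of_nonneg (.of_forall fun x => by positivity) (integrable_const _)
      (.of_forall fun x => pow_le_pow_left₀ (norm_nonneg _)
        (norm_fderiv_le_of_lipschitz ℝ hH) 2)).trans ?_
    simp
  refine le_trans (ge_of_tendsto hlim ?_) hle
  filter_upwards [eventually_ne_atTop 0] with n hn
  exact integral_sq_le_rotation hH hodd hn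

/-- The homogeneous extension of a Lipschitz function which is bounded on the unit sphere. -/
lemma lipschitzWith_norm_mul_normalize {ψ : EuclideanSpace ℝ (Fin d) → ℝ} {K : NNReal}
    (hψ : LipschitzWith K ψ) (hb : ∀ u, ‖u‖ = 1 → |ψ u| ≤ K) :
    LipschitzWith (3 * K) fun x => ‖x‖ * ψ (‖x‖⁻¹ • x) := by
  have hnorm : ∀ x : EuclideanSpace ℝ (Fin d), x ≠ 0 → ‖(‖x‖⁻¹ • x)‖ = 1 := fun x hx => by
    rw [norm_smul, norm_inv, norm_norm, inv_mul_cancel₀ (norm_ne_zero_iff.2 hx)]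
  refine LipschitzWith.of_dist_le_mul fun x y => ?_
  rw [Real.dist_eq, dist_eq_norm, NNReal.coe_mul, NNReal.coe_ofNat]
  have hK := K.coe_nonneg
  rcases eq_or_ne x 0 with rfl | hx
  · rcases eq_or_ne y 0 with rfl | hy
    · simp
    have := hb _ (hnorm y hy)
    simp only [norm_zero, zero_mul, zero_sub, abs_neg, abs_mul, abs_norm, norm_neg]
    nlinarith [norm_nonneg y]
  rcases eq_or_ne y 0 with rfl | hy
  · have := hb _ (hnorm x hx)
    simp only [norm_zero, zero_mul, sub_zero, abs_mul, abs_norm]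
    nlinarith [norm_nonneg x]
  -- Of the constant `3K`, the angular variation accounts for `2K` through this bound, and the
  -- radial variation for `K`.
  have h1 : ‖x‖ * ‖(‖x‖⁻¹ • x) - ‖y‖⁻¹ • y‖ ≤ 2 * ‖x - y‖ := by
    have hx0 : ‖x‖ ≠ 0 := norm_ne_zero_iff.2 hx
    have hy0 : ‖y‖ ≠ 0 := norm_ne_zero_iff.2 hy
    have h2 : ‖x‖ * ‖(‖x‖⁻¹ • x) - ‖y‖⁻¹ • y‖ = ‖(x - y) + (‖y‖ - ‖x‖) • (‖y‖⁻¹ • y)‖ := by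
      rw [← norm_norm x, ← norm_smul, norm_norm, smul_sub, smul_smul, mul_inv_cancel₀ hx0, one_smul,
        sub_smul, smul_smul ‖y‖, mul_inv_cancel₀ hy0, one_smul]
      congr 1
      abel
    rw [h2]
    refine (norm_add_le _ _).trans ?_
    rw [norm_smul, hnorm y hy, mul_one, Real.norm_eq_abs]
    have := abs_norm_sub_norm_le y x
    rw [norm_sub_rev y x] at this
    linarith
  have h3 := hψ.dist_le_mul (‖x‖⁻¹ • x) (‖y‖⁻¹ • y)
  rw [Real.dist_eq, dist_eq_norm] at h3
  have h4 : ‖x‖ * ψ (‖x‖⁻¹ • x) - ‖y‖ * ψ (‖y‖⁻¹ • y) =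
      ‖x‖ * (ψ (‖x‖⁻¹ • x) - ψ (‖y‖⁻¹ • y)) + (‖x‖ - ‖y‖) * ψ (‖y‖⁻¹ • y) := by ring
  rw [h4]
  calc _ ≤ |‖x‖ * (ψ (‖x‖⁻¹ • x) - ψ (‖y‖⁻¹ • y))| + |(‖x‖ - ‖y‖) * ψ (‖y‖⁻¹ • y)| :=
        abs_add_le _ _
    _ = ‖x‖ * |ψ (‖x‖⁻¹ • x) - ψ (‖y‖⁻¹ • y)| + |‖x‖ - ‖y‖| * |ψ (‖y‖⁻¹ • y)| := by
        rw [abs_mul, abs_mul, abs_norm]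
    _ ≤ ‖x‖ * (K * ‖(‖x‖⁻¹ • x) - ‖y‖⁻¹ • y‖) + ‖x - y‖ * K := by
        gcongr
        · exact abs_norm_sub_norm_le x y
        · exact hb _ (hnorm y hy)
    _ = K * (‖x‖ * ‖(‖x‖⁻¹ • x) - ‖y‖⁻¹ • y‖) + ‖x - y‖ * K := by ring
    _ ≤ K * (2 * ‖x - y‖) + ‖x - y‖ * K := by gcongr
    _ = _ := by ring

/-- The second moment of an odd Lipschitz function on the sphere is of order `1 / d`. -/
theorem integral_sq_unifSphere_le_of_odd [NeZero d] {ψ : EuclideanSpace ℝ (Fin d) → ℝ} {K : NNReal}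
    (hψ : LipschitzWith K ψ) (hodd : ∀ x, ψ (-x) = -ψ x) :
    4 * d * ∫ u, ψ (u : EuclideanSpace ℝ (Fin d)) ^ 2 ∂(unifSphere d) ≤
      9 * Real.pi ^ 2 * K ^ 2 := by
  have hb : ∀ u, ‖u‖ = 1 → |ψ u| ≤ K := by
    intro u hu
    have h0 : ψ 0 = 0 := by
      have := hodd 0
      rw [neg_zero] at this
      linarith
    have := hψ.dist_le_mul u 0
    rwa [Real.dist_eq, h0, sub_zero, dist_zero_right, hu, mul_one] at this
  have h1 := integral_sq_stdGaussian_le_of_odd (lipschitzWith_norm_mul_normalize hψ hb)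
    (fun x => by rw [norm_neg, smul_neg, hodd, mul_neg])
  simp_rw [mul_pow] at h1
  -- The square of the extension is `‖x‖²` times `ψ²` of the direction, and `𝔼 ‖X‖² = d` produces
  -- the dimension factor; the `9` is `3²`.
  rw [integral_stdGaussian_radial_mul_angular (fun r => r ^ 2) (fun u => ψ u ^ 2),
    integral_norm_sq_stdGaussian] at h1
  push_cast at h1
  linarith

end Gaussian

/-! ### Conditional laws and conditional expectations -/

section CondLaw

variable {Ω A T : Type*} {𝓖 : MeasurableSpace Ω} [mΩ : MeasurableSpace Ω] [MeasurableSpace A]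
  [MeasurableSpace T]

/-- If `κ (Z ω)` is the conditional law of `X` given `𝓖` and `Z` is `𝓖`-measurable, then on every
event of `𝓖` the joint law of `(Z, X)` is the composition-product of the law of `Z` with `κ`. -/
theorem HasCondLaw.map_prodMk_restrict {P : Measure Ω} [IsProbabilityMeasure P] (h𝓖 : 𝓖 ≤ mΩ)
    {Z : Ω → A} (hZ : Measurable[𝓖] Z) {X : Ω → T} (hX : Measurable[mΩ] X)
    {κ : Kernel A T} [IsMarkovKernel κ] (h : HasCondLaw P 𝓖 X fun ω => κ (Z ω))
    {G : Set Ω} (hG : MeasurableSet[𝓖] G) :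
    (P.restrict G).map (fun ω => (Z ω, X ω)) = (P.restrict G).map Z ⊗ₘ κ := by
  have hZ' : Measurable[mΩ] Z := hZ.mono h𝓖 le_rfl
  refine Measure.ext_prod fun {s t} hs ht => ?_
  rw [Measure.compProd_apply_prod hs ht, setLIntegral_map hs (κ.measurable_coe ht) hZ',
    Measure.map_apply (hZ'.prodMk hX) (hs.prod ht), Measure.restrict_restrict (hZ' hs)]
  -- Since `Z` is `𝓖`-measurable, the rectangle's first side can be absorbed into the conditioning
  -- event.
  have hG' : MeasurableSet[𝓖] (Z ⁻¹' s ∩ G) := (hZ hs).inter hG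
  have hXt : MeasurableSet[mΩ] (X ⁻¹' t) := hX ht
  have h1 := setIntegral_condExp h𝓖 (f := (X ⁻¹' t).indicator fun _ => (1 : ℝ)) (μ := P)
    ((integrable_const 1).indicator hXt) hG'
  rw [setIntegral_congr_ae (g := fun ω => (κ (Z ω)).real t) (h𝓖 _ hG')
    ((h t ht).mono fun ω hω _ => hω), setIntegral_indicator hXt, setIntegral_const, smul_eq_mul,
    mul_one] at h1
  have hint : Integrable (fun ω => (κ (Z ω)).real t) (P.restrict (Z ⁻¹' s ∩ G)) := by
    refine Integrable.of_bound (C := 1) ?_ (.of_forall fun ω => ?_)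
    · exact ((κ.measurable_coe ht).comp hZ').ennreal_toReal.aestronglyMeasurable
    · rw [Real.norm_of_nonneg measureReal_nonneg]
      exact measureReal_le_one
  have h2 : ∫⁻ ω in Z ⁻¹' s ∩ G, κ (Z ω) t ∂P =
      ENNReal.ofReal (∫ ω in Z ⁻¹' s ∩ G, (κ (Z ω)).real t ∂P) := by
    rw [ofReal_integral_eq_lintegral_ofReal hint (.of_forall fun ω => measureReal_nonneg)]
    simp
  rw [h2, h1, ofReal_measureReal, Measure.restrict_apply ((hZ'.prodMk hX) (hs.prod ht))]
  congr 1
  ext ω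
  simp only [Set.mem_inter_iff, Set.mem_preimage, Set.mem_prod]
  tauto

/-- Composition of two conditional laws. -/
theorem HasCondLaw.map_prodMk_prodMk_restrict {U : Type*} [mU : MeasurableSpace U]
    {P : Measure Ω} [IsProbabilityMeasure P] (h𝓖 : 𝓖 ≤ mΩ)
    {Z : Ω → A} (hZ : Measurable[𝓖] Z) {u : Ω → U} (hu : Measurable[mΩ] u)
    {X : Ω → T} (hX : Measurable[mΩ] X) {η : Kernel A U} [IsMarkovKernel η]
    {κ : Kernel (A × U) T} [IsMarkovKernel κ] (h₁ : HasCondLaw P 𝓖 u fun ω => η (Z ω))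
    (h₂ : HasCondLaw P (𝓖 ⊔ MeasurableSpace.comap u mU) X fun ω => κ (Z ω, u ω))
    {G : Set Ω} (hG : MeasurableSet[𝓖] G) :
    (P.restrict G).map (fun ω => (Z ω, (u ω, X ω))) = (P.restrict G).map Z ⊗ₘ (η ⊗ₖ κ) := by
  have hZ' : Measurable[mΩ] Z := hZ.mono h𝓖 le_rfl
  have hsup : 𝓖 ⊔ MeasurableSpace.comap u mU ≤ mΩ := sup_le h𝓖 hu.comap_le
  have hZu : Measurable[𝓖 ⊔ MeasurableSpace.comap u mU] fun ω => (Z ω, u ω) :=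
    Measurable.prodMk (hZ.mono le_sup_left le_rfl)
      ((comap_measurable u).mono le_sup_right le_rfl)
  rw [← Measure.compProd_assoc', ← h₁.map_prodMk_restrict h𝓖 hZ hu hG,
    ← h₂.map_prodMk_restrict hsup hZu hX ((le_sup_left : 𝓖 ≤ _) _ hG),
    Measure.map_map (MeasurableEquiv.measurable _) ((hZ'.prodMk hu).prodMk hX)]
  rfl

/-- If, on every event of `𝓖`, the joint law of `(Z, W)` is a composition-product with the kernel
`ν`, then conditional expectations given `𝓖` of functions of `(Z, W)` are integrals against `ν`. -/
theorem condExp_ae_eq_integral_kernel {V : Type*} [NormedAddCommGroup V] [NormedSpace ℝ V]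
    [CompleteSpace V] {P : Measure Ω} [IsProbabilityMeasure P] (h𝓖 : 𝓖 ≤ mΩ)
    {Z : Ω → A} (hZ : Measurable[𝓖] Z) {W : Ω → T} (hW : Measurable[mΩ] W) {ν : Kernel A T}
    [IsMarkovKernel ν]
    (h : ∀ G, MeasurableSet[𝓖] G →
      (P.restrict G).map (fun ω => (Z ω, W ω)) = (P.restrict G).map Z ⊗ₘ ν)
    {Φ : A × T → V} (hΦ : StronglyMeasurable Φ) (hint : Integrable (fun ω => Φ (Z ω, W ω)) P) :
    P[fun ω => Φ (Z ω, W ω) | 𝓖] =ᵐ[P] fun ω => ∫ w, Φ (Z ω, w) ∂(ν (Z ω)) := by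
  have hZ' : Measurable[mΩ] Z := hZ.mono h𝓖 le_rfl
  have hm : StronglyMeasurable fun z => ∫ w, Φ (z, w) ∂(ν z) :=
    hΦ.integral_kernel_prod_right'
  have hmap : ∀ G, MeasurableSet[𝓖] G →
      Integrable Φ ((P.restrict G).map Z ⊗ₘ ν) := by
    intro G hG
    rw [← h G hG, integrable_map_measure hΦ.aestronglyMeasurable (hZ'.prodMk hW).aemeasurable]
    exact hint.integrableOn
  refine (ae_eq_condExp_of_forall_setIntegral_eq h𝓖 hint (fun G hG _ => ?_) (fun G hG _ => ?_)
    (hm.comp_measurable hZ).aestronglyMeasurable).symm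
  · have h1 : Integrable (fun z => ∫ w, Φ (z, w) ∂(ν z)) ((P.restrict G).map Z) :=
      ((Measure.integrable_compProd_iff hΦ.aestronglyMeasurable).1 (hmap G hG)).2.mono'
        hm.aestronglyMeasurable (.of_forall fun z => norm_integral_le_integral_norm _)
    rwa [integrable_map_measure hm.aestronglyMeasurable hZ'.aemeasurable] at h1
  · rw [← integral_map (φ := fun ω => (Z ω, W ω)) (f := Φ) (hZ'.prodMk hW).aemeasurable
      hΦ.aestronglyMeasurable, h G hG, Measure.integral_compProd (hmap G hG),
      integral_map hZ'.aemeasurable hm.aestronglyMeasurable]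
    rfl

/-- Square integrability of a function of `(Z, W)` from a uniform bound on its second moments
against the kernel `ν`. -/
theorem memLp_two_of_lintegral_kernel_le {V : Type*} [NormedAddCommGroup V] {P : Measure Ω}
    [IsProbabilityMeasure P] {Z : Ω → A} (hZ : Measurable Z) {W : Ω → T} (hW : Measurable W)
    {ν : Kernel A T} [IsMarkovKernel ν] (h : P.map (fun ω => (Z ω, W ω)) = P.map Z ⊗ₘ ν)
    {Φ : A × T → V} (hΦ : StronglyMeasurable Φ) {C : ℝ}
    (hC : ∀ z, ∫⁻ w, ENNReal.ofReal (‖Φ (z, w)‖ ^ 2) ∂(ν z) ≤ ENNReal.ofReal C) :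
    MemLp (fun ω => Φ (Z ω, W ω)) 2 P := by
  have hm : StronglyMeasurable fun ω => Φ (Z ω, W ω) := hΦ.comp_measurable (hZ.prodMk hW)
  have hn : Measurable fun p => ENNReal.ofReal (‖Φ p‖ ^ 2) :=
    (hΦ.norm.measurable.pow_const 2).ennreal_ofReal
  rw [← memLp_norm_iff hm.aestronglyMeasurable,
    memLp_two_iff_integrable_sq hm.norm.aestronglyMeasurable]
  refine ⟨(hm.norm.pow 2).aestronglyMeasurable, ?_⟩
  rw [hasFiniteIntegral_iff_ofReal (.of_forall fun s => sq_nonneg _)]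
  have h1 := lintegral_map (μ := P) hn (hZ.prodMk hW)
  rw [h, Measure.lintegral_compProd hn] at h1
  rw [← h1]
  have := Measure.isProbabilityMeasure_map (μ := P) hZ.aemeasurable
  calc _ ≤ ∫⁻ _, ENNReal.ofReal C ∂(P.map Z) := lintegral_mono hC
    _ < _ := by simp

end CondLaw

/-! ### The two-point estimator at a fixed query point -/

section TwoPoint

lemma norm_twoPoint_sq {d : ℕ} {S : Type*} (F : EuclideanSpace ℝ (Fin d) → S → ℝ) (δ : ℝ) (y : EuclideanSpace ℝ (Fin d))
    (u : Metric.sphere (0 : EuclideanSpace ℝ (Fin d)) 1) (s : S × S) :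
    ‖twoPoint δ F y (u : EuclideanSpace ℝ (Fin d)) s.1 s.2‖ ^ 2 = ((d : ℝ) / (2 * δ)) ^ 2 *
      (F (y + δ • (u : EuclideanSpace ℝ (Fin d))) s.1 -
        F (y - δ • (u : EuclideanSpace ℝ (Fin d))) s.2) ^ 2 := by
  rw [twoPoint, norm_smul, norm_eq_of_mem_sphere, mul_one, Real.norm_eq_abs, sq_abs, mul_pow]

variable {d : ℕ} {S : Type*} [MeasurableSpace S]
  {D : Kernel (EuclideanSpace ℝ (Fin d)) S} {F : EuclideanSpace ℝ (Fin d) → S → ℝ} {σ : ℝ}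

lemma OracleAssumption.memLp [IsMarkovKernel D] (h : OracleAssumption D F σ)
    (x : EuclideanSpace ℝ (Fin d)) : MemLp (F x) 2 (D x) := by
  have hm : AEStronglyMeasurable (fun s => F x s - objective D F x) (D x) :=
    (h.integrable x).1.sub aestronglyMeasurable_const
  have h1 : MemLp (fun s => F x s - objective D F x) 2 (D x) := by
    rw [memLp_two_iff_integrable_sq hm]
    refine ⟨hm.pow 2, ?_⟩
    rw [hasFiniteIntegral_iff_ofReal (.of_forall fun s => sq_nonneg _)]
    simp_rw [← sq_abs (F x _ - objective D F x)]
    exact (h.variance_le x).trans_lt ENNReal.ofReal_lt_top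
  have h2 := h1.add (memLp_const (objective D F x))
  refine h2.congr_norm (h.integrable x).1 (.of_forall fun s => ?_)
  simp

lemma OracleAssumption.variance_apply_le [IsMarkovKernel D] (h : OracleAssumption D F σ)
    (x : EuclideanSpace ℝ (Fin d)) : Var[F x; D x] ≤ σ ^ 2 := by
  rw [variance_eq_integral (h.integrable x).1.aemeasurable]
  have h1 := h.variance_le x
  simp_rw [sq_abs] at h1
  rw [← ofReal_integral_eq_lintegral_ofReal
    (MemLp.integrable_sq (f := fun s => F x s - objective D F x)
      ((h.memLp x).sub (memLp_const (objective D F x))))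
    (.of_forall fun s => sq_nonneg _)] at h1
  exact (ENNReal.ofReal_le_ofReal_iff (sq_nonneg _)).1 h1

lemma OracleAssumption.memLp_sub [IsMarkovKernel D] (h : OracleAssumption D F σ)
    (p q : EuclideanSpace ℝ (Fin d)) :
    MemLp (fun s : S × S => F p s.1 - F q s.2) 2 ((D p).prod (D q)) :=
  ((h.memLp p).comp_fst _).sub ((h.memLp q).comp_snd _)

lemma OracleAssumption.integral_sub [IsMarkovKernel D] (h : OracleAssumption D F σ)
    (p q : EuclideanSpace ℝ (Fin d)) :
    ∫ s, (F p s.1 - F q s.2) ∂((D p).prod (D q)) = objective D F p - objective D F q := by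
  rw [MeasureTheory.integral_sub ((h.integrable p).comp_fst _) ((h.integrable q).comp_snd _),
    integral_fun_fst (F p), integral_fun_snd (F q)]
  simp [objective]

/-- Second moment is variance plus squared mean. Under the product law the two variances add, and no
cross term remains. -/
lemma OracleAssumption.integral_sub_sq_le [IsMarkovKernel D] (h : OracleAssumption D F σ)
    (p q : EuclideanSpace ℝ (Fin d)) :
    ∫ s, (F p s.1 - F q s.2) ^ 2 ∂((D p).prod (D q)) ≤
      2 * σ ^ 2 + (objective D F p - objective D F q) ^ 2 := by
  have h1 := variance_eq_sub (h.memLp_sub p q)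
  have h2 : Var[fun s : S × S => F p s.1 - F q s.2; (D p).prod (D q)] =
      Var[F p; D p] + Var[F q; D q] := by
    have h3 := variance_add_prod (h.memLp p) (h.memLp q).neg
    rw [variance_neg] at h3
    rw [← h3]
    simp [sub_eq_add_neg]
  rw [h.integral_sub, h2] at h1
  have h4 := h.variance_apply_le p
  have h5 := h.variance_apply_le q
  simp only [Pi.pow_apply] at h1
  linarith

/-- The joint law of the direction and the two samples, given the query point. -/
noncomputable def sampleKernel (D : Kernel (EuclideanSpace ℝ (Fin d)) S) (δ : ℝ) :
    Kernel (EuclideanSpace ℝ (Fin d) × Metric.sphere (0 : EuclideanSpace ℝ (Fin d)) 1) (S × S) :=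
  (D.comap (fun p => p.1 + δ • (p.2 : EuclideanSpace ℝ (Fin d)))
      (by fun_prop)) ×ₖ
    (D.comap (fun p => p.1 - δ • (p.2 : EuclideanSpace ℝ (Fin d))) (by fun_prop))

instance [IsMarkovKernel D] (δ : ℝ) : IsMarkovKernel (sampleKernel D δ) := by
  unfold sampleKernel
  infer_instance

lemma sampleKernel_apply [IsMarkovKernel D] (δ : ℝ) (y : EuclideanSpace ℝ (Fin d))
    (u : Metric.sphere (0 : EuclideanSpace ℝ (Fin d)) 1) :
    sampleKernel D δ (y, u) = (D (y + δ • (u : EuclideanSpace ℝ (Fin d)))).prod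
      (D (y - δ • (u : EuclideanSpace ℝ (Fin d)))) := by
  rw [sampleKernel, Kernel.prod_apply, Kernel.comap_apply, Kernel.comap_apply]

lemma measurable_twoPoint (hF : Measurable (Function.uncurry F)) (δ : ℝ) :
    Measurable fun p : EuclideanSpace ℝ (Fin d) ×
      (Metric.sphere (0 : EuclideanSpace ℝ (Fin d)) 1 × (S × S)) =>
      twoPoint δ F p.1 (p.2.1 : EuclideanSpace ℝ (Fin d)) p.2.2.1 p.2.2.2 := by
  have h1 : Measurable fun p : EuclideanSpace ℝ (Fin d) ×
      (Metric.sphere (0 : EuclideanSpace ℝ (Fin d)) 1 × (S × S)) =>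
      F (p.1 + δ • (p.2.1 : EuclideanSpace ℝ (Fin d))) p.2.2.1 :=
    hF.comp (f := fun p : EuclideanSpace ℝ (Fin d) ×
      (Metric.sphere (0 : EuclideanSpace ℝ (Fin d)) 1 × (S × S)) =>
      (p.1 + δ • (p.2.1 : EuclideanSpace ℝ (Fin d)), p.2.2.1)) (by fun_prop)
  have h2 : Measurable fun p : EuclideanSpace ℝ (Fin d) ×
      (Metric.sphere (0 : EuclideanSpace ℝ (Fin d)) 1 × (S × S)) =>
      F (p.1 - δ • (p.2.1 : EuclideanSpace ℝ (Fin d))) p.2.2.2 :=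
    hF.comp (f := fun p : EuclideanSpace ℝ (Fin d) ×
      (Metric.sphere (0 : EuclideanSpace ℝ (Fin d)) 1 × (S × S)) =>
      (p.1 - δ • (p.2.1 : EuclideanSpace ℝ (Fin d)), p.2.2.2)) (by fun_prop)
  unfold twoPoint
  fun_prop

lemma measurable_twoPoint_apply (hF : Measurable (Function.uncurry F)) (δ : ℝ)
    (y : EuclideanSpace ℝ (Fin d)) :
    Measurable fun w : Metric.sphere (0 : EuclideanSpace ℝ (Fin d)) 1 × (S × S) =>
      twoPoint δ F y (w.1 : EuclideanSpace ℝ (Fin d)) w.2.1 w.2.2 :=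
  (measurable_twoPoint hF δ).comp (measurable_prodMk_left (x := y))

variable {L δ : ℝ}

lemma lipschitzWith_objective
    (hLip : ∀ x y : EuclideanSpace ℝ (Fin d),
      |objective D F x - objective D F y| ≤ L * ‖x - y‖) :
    LipschitzWith L.toNNReal (objective D F) :=
  LipschitzWith.of_dist_le' fun x y => by
    rw [Real.dist_eq, dist_eq_norm]
    exact hLip x y

/-- The second moment of the symmetric difference in a uniform direction. -/
lemma integral_symmDiff_sq_le [NeZero d] {f : EuclideanSpace ℝ (Fin d) → ℝ}
    (hf : LipschitzWith L.toNNReal f) (hδ : 0 < δ) (y : EuclideanSpace ℝ (Fin d)) :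
    d * ∫ u, (f (y + δ • (u : EuclideanSpace ℝ (Fin d))) -
      f (y - δ • (u : EuclideanSpace ℝ (Fin d)))) ^ 2 ∂(unifSphere d) ≤
      9 * Real.pi ^ 2 * δ ^ 2 * L ^ 2 := by
  -- The symmetric difference is odd in the direction, and each of its two terms contributes `δL` to
  -- the Lipschitz constant.
  have h1 : LipschitzWith (2 * δ.toNNReal * L.toNNReal) fun v => f (y + δ • v) - f (y - δ • v) := by
    refine LipschitzWith.of_dist_le_mul fun v w => ?_
    have hp := hf.dist_le_mul (y + δ • v) (y + δ • w)
    have hm := hf.dist_le_mul (y - δ • v) (y - δ • w)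
    rw [dist_add_left, dist_smul₀, Real.norm_of_nonneg hδ.le] at hp
    rw [dist_sub_left, dist_smul₀, Real.norm_of_nonneg hδ.le] at hm
    have := dist_sub_sub_le (f (y + δ • v)) (f (y - δ • v)) (f (y + δ • w)) (f (y - δ • w))
    push_cast
    rw [Real.coe_toNNReal δ hδ.le]
    linarith
  have h2 := integral_sq_unifSphere_le_of_odd h1 fun x => by
    simp only [smul_neg, sub_neg_eq_add, ← sub_eq_add_neg]
    ring
  have h3 : (L.toNNReal : ℝ) ^ 2 ≤ L ^ 2 := by
    rw [← sq_abs L]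
    gcongr
    rw [Real.coe_toNNReal']
    exact max_le (le_abs_self L) (abs_nonneg L)
  push_cast at h2
  rw [Real.coe_toNNReal δ hδ.le] at h2
  have h4 : 9 * Real.pi ^ 2 * (2 * δ * (L.toNNReal : ℝ)) ^ 2 ≤
      9 * Real.pi ^ 2 * (2 * δ * L) ^ 2 := by
    rw [mul_pow, mul_pow (2 * δ)]
    gcongr
  linarith

/-- The Gaussian argument yields the constant `9π²/4`, which is below the stated `16 √(2π)`; both
are multiplied by `4` here. -/
lemma nine_mul_pi_sq_le : 9 * Real.pi ^ 2 ≤ 64 * Real.sqrt (2 * Real.pi) := by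
  have h1 : (2.5 : ℝ) ≤ Real.sqrt (2 * Real.pi) := by
    refine Real.le_sqrt_of_sq_le ?_
    have := Real.pi_gt_d2
    norm_num
    linarith
  have h2 : Real.pi ^ 2 ≤ 3.15 ^ 2 := by
    have := Real.pi_lt_d2
    have := Real.pi_pos
    gcongr
  norm_num at h2
  linarith

variable [NeZero d] [IsMarkovKernel D]

/-- Stated in `[0, ∞]`, so that the same bound also gives square integrability. -/
lemma lintegral_norm_twoPoint_sq_le (hF : Measurable (Function.uncurry F))
    (hOracle : OracleAssumption D F σ) (hf : LipschitzWith L.toNNReal (objective D F))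
    (hδ : 0 < δ) (y : EuclideanSpace ℝ (Fin d)) :
    ∫⁻ w, ENNReal.ofReal (‖twoPoint δ F y (w.1 : EuclideanSpace ℝ (Fin d)) w.2.1 w.2.2‖ ^ 2)
      ∂((Kernel.const _ (unifSphere d) ⊗ₖ sampleKernel D δ) y) ≤
      ENNReal.ofReal ((d : ℝ) ^ 2 * σ ^ 2 / (2 * δ ^ 2)
        + 16 * Real.sqrt (2 * Real.pi) * d * L ^ 2) := by
  have hd : (0 : ℝ) < d := Nat.cast_pos.2 (NeZero.pos d)
  have hΦ := measurable_twoPoint_apply hF δ y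
  have hmeas : Measurable fun w : Metric.sphere (0 : EuclideanSpace ℝ (Fin d)) 1 × (S × S) =>
      ENNReal.ofReal (‖twoPoint δ F y (w.1 : EuclideanSpace ℝ (Fin d)) w.2.1 w.2.2‖ ^ 2) :=
    (hΦ.norm.pow_const 2).ennreal_ofReal
  rw [Kernel.lintegral_compProd _ _ _ hmeas, Kernel.const_apply]
  have hcont : Continuous fun u : Metric.sphere (0 : EuclideanSpace ℝ (Fin d)) 1 =>
      ((d : ℝ) / (2 * δ)) ^ 2 * (2 * σ ^ 2 +
        (objective D F (y + δ • (u : EuclideanSpace ℝ (Fin d))) -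
          objective D F (y - δ • (u : EuclideanSpace ℝ (Fin d)))) ^ 2) := by
    have := hf.continuous
    fun_prop
  have hcont2 : Continuous fun u : Metric.sphere (0 : EuclideanSpace ℝ (Fin d)) 1 =>
      (objective D F (y + δ • (u : EuclideanSpace ℝ (Fin d))) -
          objective D F (y - δ • (u : EuclideanSpace ℝ (Fin d)))) ^ 2 := by
    have := hf.continuous
    fun_prop
  calc _ ≤ ∫⁻ u, ENNReal.ofReal (((d : ℝ) / (2 * δ)) ^ 2 * (2 * σ ^ 2 +
        (objective D F (y + δ • (u : EuclideanSpace ℝ (Fin d))) -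
          objective D F (y - δ • (u : EuclideanSpace ℝ (Fin d)))) ^ 2)) ∂(unifSphere d) := by
        refine lintegral_mono fun u => ?_
        simp_rw [norm_twoPoint_sq, sampleKernel_apply]
        rw [← ofReal_integral_eq_lintegral_ofReal
          ((hOracle.memLp_sub _ _).integrable_sq.const_mul _)
          (.of_forall fun s => by positivity), integral_const_mul]
        gcongr
        exact hOracle.integral_sub_sq_le _ _
    _ = ENNReal.ofReal (((d : ℝ) / (2 * δ)) ^ 2 * (2 * σ ^ 2 +
        ∫ u, (objective D F (y + δ • (u : EuclideanSpace ℝ (Fin d))) -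
          objective D F (y - δ • (u : EuclideanSpace ℝ (Fin d)))) ^ 2 ∂(unifSphere d))) := by
        rw [← ofReal_integral_eq_lintegral_ofReal (integrable_unifSphere_of_continuous hcont)
          (.of_forall fun u => by positivity), integral_const_mul,
          integral_add (integrable_const _) (integrable_unifSphere_of_continuous hcont2)]
        simp
    _ ≤ _ := by
        refine ENNReal.ofReal_le_ofReal ?_
        have h1 := integral_symmDiff_sq_le hf hδ y
        set I := ∫ u, (objective D F (y + δ • (u : EuclideanSpace ℝ (Fin d))) -
          objective D F (y - δ • (u : EuclideanSpace ℝ (Fin d)))) ^ 2 ∂(unifSphere d)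
        have h2 : (d : ℝ) * I ≤ 64 * Real.sqrt (2 * Real.pi) * δ ^ 2 * L ^ 2 := by
          refine h1.trans ?_
          have := nine_mul_pi_sq_le
          gcongr ?_ * δ ^ 2 * L ^ 2
        have h3 : ((d : ℝ) / (2 * δ)) ^ 2 * (2 * σ ^ 2 + I) =
            (d : ℝ) ^ 2 * σ ^ 2 / (2 * δ ^ 2) + d / (4 * δ ^ 2) * (d * I) := by
          field_simp
          ring
        rw [h3]
        have h4 : 16 * Real.sqrt (2 * Real.pi) * d * L ^ 2 =
            d / (4 * δ ^ 2) * (64 * Real.sqrt (2 * Real.pi) * δ ^ 2 * L ^ 2) := by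
          field_simp
          ring
        rw [h4]
        gcongr

lemma memLp_twoPoint (hF : Measurable (Function.uncurry F))
    (hOracle : OracleAssumption D F σ) (hf : LipschitzWith L.toNNReal (objective D F))
    (hδ : 0 < δ) (y : EuclideanSpace ℝ (Fin d)) :
    MemLp (fun w : Metric.sphere (0 : EuclideanSpace ℝ (Fin d)) 1 × (S × S) =>
      twoPoint δ F y (w.1 : EuclideanSpace ℝ (Fin d)) w.2.1 w.2.2) 2
      ((Kernel.const _ (unifSphere d) ⊗ₖ sampleKernel D δ) y) := by
  have hΦ := measurable_twoPoint_apply hF δ y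
  rw [← memLp_norm_iff hΦ.aestronglyMeasurable,
    memLp_two_iff_integrable_sq hΦ.norm.aestronglyMeasurable]
  refine ⟨(hΦ.norm.pow_const 2).aestronglyMeasurable, ?_⟩
  rw [hasFiniteIntegral_iff_ofReal (.of_forall fun s => sq_nonneg _)]
  exact (lintegral_norm_twoPoint_sq_le hF hOracle hf hδ y).trans_lt ENNReal.ofReal_lt_top

lemma integral_norm_twoPoint_sq_le (hF : Measurable (Function.uncurry F))
    (hOracle : OracleAssumption D F σ) (hf : LipschitzWith L.toNNReal (objective D F))
    (hδ : 0 < δ) (y : EuclideanSpace ℝ (Fin d)) :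
    ∫ w, ‖twoPoint δ F y (w.1 : EuclideanSpace ℝ (Fin d)) w.2.1 w.2.2‖ ^ 2
      ∂((Kernel.const _ (unifSphere d) ⊗ₖ sampleKernel D δ) y) ≤
      (d : ℝ) ^ 2 * σ ^ 2 / (2 * δ ^ 2) + 16 * Real.sqrt (2 * Real.pi) * d * L ^ 2 := by
  have h := lintegral_norm_twoPoint_sq_le hF hOracle hf hδ y
  rw [← ofReal_integral_eq_lintegral_ofReal (memLp_twoPoint hF hOracle hf hδ y).norm.integrable_sq
    (.of_forall fun s => sq_nonneg _)] at h
  exact (ENNReal.ofReal_le_ofReal_iff (by positivity)).1 h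

/-- Integrating the samples out first leaves the symmetric difference of the objective, whose
spherical mean is `gradient_smoothed`. -/
lemma integral_twoPoint (hF : Measurable (Function.uncurry F))
    (hOracle : OracleAssumption D F σ) (hf : LipschitzWith L.toNNReal (objective D F))
    (hδ : 0 < δ) (y : EuclideanSpace ℝ (Fin d)) :
    ∫ w, twoPoint δ F y (w.1 : EuclideanSpace ℝ (Fin d)) w.2.1 w.2.2
      ∂((Kernel.const _ (unifSphere d) ⊗ₖ sampleKernel D δ) y) =
      gradient (smoothed δ (objective D F)) y := by
  rw [ProbabilityTheory.integral_compProd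
    ((memLp_twoPoint hF hOracle hf hδ y).integrable one_le_two), Kernel.const_apply,
    gradient_smoothed hf hδ]
  refine integral_congr_ae (.of_forall fun u => ?_)
  simp only [twoPoint, sampleKernel_apply]
  rw [integral_smul_const, integral_const_mul, hOracle.integral_sub]

end TwoPoint

/-! ### Assembly: from a fixed query point to conditional expectations. -/

theorem lemma3p1
    (d : ℕ) (hd : 1 ≤ d) {S : Type*} [MeasurableSpace S]
    -- the decision-dependent distribution, the oracle, and the assumptions on them
    (D : Kernel (EuclideanSpace ℝ (Fin d)) S) [IsMarkovKernel D]
    (F : EuclideanSpace ℝ (Fin d) → S → ℝ) (hF : Measurable (Function.uncurry F))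
    (σ L δ : ℝ) (hδ : 0 < δ)
    (hOracle : OracleAssumption D F σ)
    (hLip : ∀ x y : EuclideanSpace ℝ (Fin d),
      |objective D F x - objective D F y| ≤ L * ‖x - y‖)
    -- the probability space, the past `𝓕` and the query point, which is known from the past
    {Ω : Type*} (𝓕 : MeasurableSpace Ω) [mΩ : MeasurableSpace Ω] (h𝓕 : 𝓕 ≤ mΩ)
    (P : Measure Ω) [IsProbabilityMeasure P]
    (y : Ω → EuclideanSpace ℝ (Fin d)) (hy : Measurable[𝓕] y)
    -- the direction: uniform on the sphere, independently of the past
    (u : Ω → Metric.sphere (0 : EuclideanSpace ℝ (Fin d)) 1) (hu : Measurable[mΩ] u)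
    (hu_law : HasCondLaw P 𝓕 u (fun _ => unifSphere d))
    -- the samples: given the past and the direction, independent with laws `D (y ± δ u)`
    (ξp ξm : Ω → S) (hξp : Measurable[mΩ] ξp) (hξm : Measurable[mΩ] ξm)
    (hξ_law : HasCondLaw P (𝓕 ⊔ MeasurableSpace.comap u inferInstance)
      (fun ω => (ξp ω, ξm ω))
      (fun ω => (D (y ω + δ • (u ω : EuclideanSpace ℝ (Fin d)))).prod
        (D (y ω - δ • (u ω : EuclideanSpace ℝ (Fin d)))))) :
    -- the gradient and the conditional expectations below are genuine
    Differentiable ℝ (smoothed δ (objective D F)) ∧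
    MemLp (fun ω => twoPoint δ F (y ω) (u ω) (ξp ω) (ξm ω)) 2 P ∧
    -- conditional unbiasedness
    P[fun ω => twoPoint δ F (y ω) (u ω) (ξp ω) (ξm ω) | 𝓕]
      =ᵐ[P] (fun ω => gradient (smoothed δ (objective D F)) (y ω)) ∧
    -- conditional second moment
    P[fun ω => ‖twoPoint δ F (y ω) (u ω) (ξp ω) (ξm ω)‖ ^ 2 | 𝓕]
      ≤ᵐ[P] (fun _ => (d : ℝ) ^ 2 * σ ^ 2 / (2 * δ ^ 2)
        + 16 * Real.sqrt (2 * Real.pi) * d * L ^ 2) := by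
  have : NeZero d := ⟨Nat.one_le_iff_ne_zero.1 hd⟩
  have hf : LipschitzWith L.toNNReal (objective D F) := lipschitzWith_objective hLip
  have hy' : Measurable[mΩ] y := hy.mono h𝓕 le_rfl
  have hW : Measurable[mΩ] fun ω => (u ω, (ξp ω, ξm ω)) := hu.prodMk (hξp.prodMk hξm)
  -- Given the past, the direction and the samples jointly follow one kernel evaluated at `y`.
  -- Having this on every past event, not only on `Ω`, identifies expectations conditional on all of
  -- `𝓕` and not merely on `y`.
  have hlaw : ∀ G, MeasurableSet[𝓕] G →
      (P.restrict G).map (fun ω => (y ω, (u ω, (ξp ω, ξm ω)))) =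
        (P.restrict G).map y ⊗ₘ (Kernel.const _ (unifSphere d) ⊗ₖ sampleKernel D δ) := by
    intro G hG
    refine HasCondLaw.map_prodMk_prodMk_restrict h𝓕 hy hu (hξp.prodMk hξm)
      (η := Kernel.const _ (unifSphere d)) (κ := sampleKernel D δ) hu_law ?_ hG
    simpa only [sampleKernel_apply] using hξ_law
  set Φ : EuclideanSpace ℝ (Fin d) × (Metric.sphere (0 : EuclideanSpace ℝ (Fin d)) 1 × (S × S)) →
    EuclideanSpace ℝ (Fin d) := fun p =>
      twoPoint δ F p.1 (p.2.1 : EuclideanSpace ℝ (Fin d)) p.2.2.1 p.2.2.2 with hΦ_def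
  have hΦ : Measurable Φ := measurable_twoPoint hF δ
  have hmem : MemLp (fun ω => Φ (y ω, (u ω, (ξp ω, ξm ω)))) 2 P := by
    have huniv := hlaw Set.univ MeasurableSet.univ
    rw [Measure.restrict_univ] at huniv
    exact memLp_two_of_lintegral_kernel_le hy' hW huniv hΦ.stronglyMeasurable
      fun z => lintegral_norm_twoPoint_sq_le hF hOracle hf hδ z
  have hmean := condExp_ae_eq_integral_kernel h𝓕 hy hW hlaw hΦ.stronglyMeasurable
    (hmem.integrable one_le_two)
  have hsq := condExp_ae_eq_integral_kernel h𝓕 hy hW hlaw (Φ := fun p => ‖Φ p‖ ^ 2)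
    (hΦ.norm.pow_const 2).stronglyMeasurable hmem.norm.integrable_sq
  refine ⟨fun x => (hasGradientAt_smoothed hf hδ x).differentiableAt, hmem, ?_, ?_⟩
  · filter_upwards [hmean] with ω hω
    exact hω.trans (integral_twoPoint hF hOracle hf hδ (y ω))
  · filter_upwards [hsq] with ω hω
    exact hω.trans_le (integral_norm_twoPoint_sq_le hF hOracle hf hδ (y ω))
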